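/- Let $I=[a,b]$, $a<b$, be a bounded interval. For $\varphi\in L^1(I)$ and a subinterval $K\subset I$ write $\langle\varphi\rangle_K=\frac1{|K|}\int_K\varphi$. Let $\mathrm{BMO}(I)$ be the set of real functions $\varphi\in L^1(I)$ for which there is a constant $C\ge0$ with $\langle|\varphi-\langle\varphi\rangle_K|^2\rangle_K\le C^2$ for all nondegenerate intervals $K\subset I$; let $\|\varphi\|$ be the least such $C$, and for $\varepsilon>0$ let $\mathrm{BMO}_\varepsilon(I)=\{\varphi\in\mathrm{BMO}(I):\|\varphi\|\le\varepsilon\}$. (a) For all $\varepsilon>0$, $\lambda\in\mathbb R$ and $\varphi\in\mathrm{BMO}_\varepsilon(I)$, $$\frac1{|I|}\bigl|\{s\in I:|\varphi(s)-\langle\varphi\rangle_I|\ge\lambda\}\bigr|\le\begin{cases}1,&\lambda\le\varepsilon,\\[2pt] \varepsilon^2/\lambda^2,&\varepsilon\le\lambda\le2\varepsilon,\\[2pt] \frac{e^2}{4}e^{-\lambda/\varepsilon},&2\varepsilon\le\lambda,\end{cases}$$ and this bound is sharp: for all $\varepsilon>0$ and $\lambda\in\mathbb R$ equality holds for some $\varphi\in\mathrm{BMO}_\varepsilon(I)$.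 (b) Consider the weak John–Nirenberg inequality $$\frac1{|I|}\bigl|\{s\in I:|\varphi(s)-\langle\varphi\rangle_I|\ge\lambda\}\bigr|\le c_1e^{-c_2\lambda/\|\varphi\|}\qquad(\ast)$$ for functions $\varphi\in\mathrm{BMO}(I)$ with $\|\varphi\|>0$. The largest $c_2$ for which there is a $c_1$ such that $(\ast)$ holds for all such $\varphi$ and all $\lambda\in\mathbb R$ is $c_2=1$; it is also the largest $c_2$ if $(\ast)$ is required only for $\lambda\ge2\|\varphi\|$. For $c_2=1$, the smallest $c_1$ such that $(\ast)$ holds for all such $\varphi$ and all $\lambda\ge2\|\varphi\|$ is $c_1=e^2/4$, and the smallest $c_1$ such that $(\ast)$ holds for all such $\varphi$ and all $\lambda\in\mathbb R$ is $c_1=e$. -/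

import Mathlib

open MeasureTheory

noncomputable section

/-- The average `⟨φ⟩_I = |I|⁻¹ ∫_I φ` of `φ` over the interval `I = [c, d]`. -/
def intervalAvg (c d : ℝ) (φ : ℝ → ℝ) : ℝ :=
  (d - c)⁻¹ * ∫ s in Set.Icc c d, φ s

/-- `φ` is integrable on `J = [a, b]` and `⟨|φ - ⟨φ⟩_I|²⟩_I ≤ C²` for all nondegenerate
subintervals `I = [c, d]` of `J`. The integrability of `|φ - ⟨φ⟩_I|²` is required explicitly, since
the Bochner integral of a non-integrable function is zero by convention. -/
def HasOscillationBound (a b : ℝ) (φ : ℝ → ℝ) (C : ℝ) : Prop :=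
  IntegrableOn φ (Set.Icc a b) ∧
    ∀ c d : ℝ, a ≤ c → c < d → d ≤ b →
      IntegrableOn (fun s => |φ s - intervalAvg c d φ| ^ 2) (Set.Icc c d) ∧
        intervalAvg c d (fun s => |φ s - intervalAvg c d φ| ^ 2) ≤ C ^ 2

/-- The space `BMO([a, b])`, with mean oscillations measured in `L²`. -/
def BMO (a b : ℝ) : Set (ℝ → ℝ) :=
  {φ | ∃ C : ℝ, 0 ≤ C ∧ HasOscillationBound a b φ C}

/-- The `L²`-based BMO norm on `[a, b]`: the best constant `C`. -/
def bmoNorm (a b : ℝ) (φ : ℝ → ℝ) : ℝ :=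
  sInf {C : ℝ | 0 ≤ C ∧ HasOscillationBound a b φ C}

/-- `BMO_ε([a, b])`, the functions in `BMO([a, b])` of norm at most `ε`. -/
def BMOBall (a b ε : ℝ) : Set (ℝ → ℝ) :=
  {φ | φ ∈ BMO a b ∧ bmoNorm a b φ ≤ ε}

/-- `|I|⁻¹ |{s ∈ I : |φ(s) - ⟨φ⟩_I| ≥ t}|` for `I = [a, b]`. -/
def oscillationTail (a b t : ℝ) (φ : ℝ → ℝ) : ℝ :=
  (b - a)⁻¹ * volume.real {s ∈ Set.Icc a b | t ≤ |φ s - intervalAvg a b φ|}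

/-- The weak form of the John–Nirenberg inequality holds on `[a, b]`, with constants `c₁`, `c₂`. -/
def WeakJohnNirenberg (a b c₁ c₂ : ℝ) : Prop :=
  ∀ φ ∈ BMO a b, 0 < bmoNorm a b φ → ∀ t : ℝ,
    oscillationTail a b t φ ≤ c₁ * Real.exp (-(c₂ * t / bmoNorm a b φ))

/-- The weak form of the John–Nirenberg inequality holds on `[a, b]`, with constants `c₁`, `c₂`,
for all levels that are at least twice the norm of the function. -/
def WeakJohnNirenbergLarge (a b c₁ c₂ : ℝ) : Prop :=
  ∀ φ ∈ BMO a b, 0 < bmoNorm a b φ → ∀ t : ℝ, 2 * bmoNorm a b φ ≤ t →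
    oscillationTail a b t φ ≤ c₁ * Real.exp (-(c₂ * t / bmoNorm a b φ))

end

/-! After centring and dividing by `ε`, the variance is at most 1 on every subinterval. The first
two ranges are then the trivial bound and Chebyshev's inequality.

For the exponential range put `A(w) = ∫_J (φ - w)²`. If the mean of `φ` on `J` is exactly `w + 1`,
the variance bound gives `A(w) ≤ 2|J|`, so `A'(w) = -2|J| ≤ -A(w)`: raising the centre shrinks the
second moment at exponential rate. An interval of mean at most `w + 1` is cut, by a rising sun
argument (`integral_nonneg_of_integral_nonpos`), into intervals of mean exactly `w + 1` and a set
where `φ ≤ w + 1` almost everywhere, which essentially misses the level set. Repeating this in small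
steps and ending with Chebyshev at distance 2 gives `|{φ ≥ w + u + 2}| ≤ ¼ e^{-u} A(w)`. Applied
with `w = 0` to the positive and negative parts, whose squares add up to `φ²`, it bounds the
two-sided tail by `¼ e^{-u}`.

For sharpness, a nonincreasing profile on `[0, 2]` is extended oddly to `[0, 4]`; by monotonicity
only the initial intervals `[0, q]` need testing. The extremals are a two-valued step and a
truncated logarithm: `-log s` has variance exactly 1 on each `[0, q]`, and its unbounded top can be
replaced by two values at distance 2 with the same first two moments.

For the weak inequality, an extremal in the unit ball must have norm exactly 1, since a smaller norm
would improve the upper bound. Large levels then force `c₂ ≤ 1`, level 2 forces `c₁ ≥ e²/4`, and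
level 1, where the tail equals 1, forces `c₁ ≥ e`. -/

/-! ### Rising sun lemmas -/

/-- An integrable function whose integrals over the components of an open bounded subset of the
line are nonnegative has a nonnegative integral over that set. -/
theorem setIntegral_nonneg_of_components {U : Set ℝ} {c d : ℝ} {k : ℝ → ℝ} (hU : IsOpen U)
    (hUcd : U ⊆ Set.Icc c d) (hk : IntegrableOn k U)
    (h : ∀ p q, p < q → Set.Ioo p q ⊆ U → p ∉ U → q ∉ U → 0 ≤ ∫ s in Set.Ioo p q, k s) :
    0 ≤ ∫ s in U, k s := by
  let ι := {C : Set ℝ // ∃ x ∈ U, C = connectedComponentIn U x}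
  have hne : ∀ i : ι, (i : Set ℝ).Nonempty := by
    rintro ⟨_, x, hx, rfl⟩
    exact ⟨x, mem_connectedComponentIn hx⟩
  have hopen : ∀ i : ι, IsOpen (i : Set ℝ) := by
    rintro ⟨_, x, hx, rfl⟩
    exact hU.connectedComponentIn
  have hdisj : Pairwise (Function.onFun Disjoint fun i : ι => (i : Set ℝ)) := by
    rintro ⟨_, x, hx, rfl⟩ ⟨_, y, hy, rfl⟩ hij
    rw [Function.onFun, Set.disjoint_left]
    intro z hz hz'
    apply hij
    ext1
    exact (connectedComponentIn_eq hz).trans (connectedComponentIn_eq hz').symm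
  have hcount : Countable ι := hdisj.countable_of_isOpen_disjoint hopen hne
  have hUeq : U = ⋃ i : ι, (i : Set ℝ) := by
    ext x
    simp only [Set.mem_iUnion]
    constructor
    · intro hx
      exact ⟨⟨_, x, hx, rfl⟩, mem_connectedComponentIn hx⟩
    · rintro ⟨⟨_, y, hy, rfl⟩, hx⟩
      exact connectedComponentIn_subset _ _ hx
  have hsum := hasSum_integral_iUnion (f := k) (μ := volume)
    (fun i : ι => (hopen i).measurableSet) hdisj (hUeq ▸ hk)
  rw [← hUeq] at hsum
  refine hsum.nonneg ?_
  rintro ⟨C, x, hx, rfl⟩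
  set C := connectedComponentIn U x with hC
  have hxC : x ∈ C := mem_connectedComponentIn hx
  have hCU : C ⊆ U := connectedComponentIn_subset _ _
  have hCo : IsOpen C := hU.connectedComponentIn
  have hconn : IsConnected C := ⟨⟨x, hxC⟩, isPreconnected_connectedComponentIn⟩
  have hbb : BddBelow C := ⟨c, fun y hy => (hUcd (hCU hy)).1⟩
  have hba : BddAbove C := ⟨d, fun y hy => (hUcd (hCU hy)).2⟩
  have hsub1 := hconn.Ioo_csInf_csSup_subset hbb hba
  have hsub2 : C ⊆ Set.Ioo (sInf C) (sSup C) := by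
    intro y hy
    obtain ⟨e, he, hball⟩ := Metric.isOpen_iff.1 hCo y hy
    have h1 : y - e / 2 ∈ C := hball (by simp [abs_of_pos he]; linarith)
    have h2 : y + e / 2 ∈ C := hball (by simp [abs_of_pos he]; linarith)
    exact ⟨by linarith [csInf_le hbb h1], by linarith [le_csSup hba h2]⟩
  have hCeq : C = Set.Ioo (sInf C) (sSup C) := hsub2.antisymm hsub1
  have hlt : sInf C < sSup C := (hsub2 hxC).1.trans (hsub2 hxC).2
  have hmem : ∀ y ∈ Set.Icc (sInf C) (sSup C), y ∉ C → y ∉ U := by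
    intro y hyI hyC hyU
    -- A component is maximal: an endpoint lying in `U` could be adjoined to `C` without losing
    -- connectedness.
    have hpre : IsPreconnected (insert y C) := by
      refine hconn.isPreconnected.subset_closure (Set.subset_insert y C) ?_
      rw [hCeq, closure_Ioo hlt.ne, ← hCeq]
      rintro z (rfl | hz)
      · exact hyI
      · exact Set.Ioo_subset_Icc_self (hsub2 hz)
    have := hpre.subset_connectedComponentIn (x := x) (Set.mem_insert_of_mem _ hxC)
      (Set.insert_subset hyU hCU)
    exact hyC (this (Set.mem_insert _ _))
  show 0 ≤ ∫ s in C, k s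
  rw [hCeq]
  exact h _ _ hlt (hsub1.trans hCU)
    (hmem _ (Set.left_mem_Icc.2 hlt.le) fun h => lt_irrefl _ (hsub2 h).1)
    (hmem _ (Set.right_mem_Icc.2 hlt.le) fun h => lt_irrefl _ (hsub2 h).2)

/-- A growth lemma of rising sun type, on an interval `[c, τ]` on which the primitive of `g` is
minimal at the right end. -/
theorem integral_nonneg_of_primitive_min_right {g k : ℝ → ℝ} {c τ : ℝ} (hcτ : c ≤ τ)
    (hg : IntervalIntegrable g volume c τ) (hk : IntervalIntegrable k volume c τ)
    (hmin : ∀ t ∈ Set.Icc c τ, ∫ s in c..τ, g s ≤ ∫ s in c..t, g s)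
    (h : ∀ p q, c ≤ p → p < q → q ≤ τ → ∫ s in p..q, g s = 0 → 0 ≤ ∫ s in p..q, k s)
    (hneg : ∀ s, g s ≤ 0 → 0 ≤ k s) : 0 ≤ ∫ s in c..τ, k s := by
  set F : ℝ → ℝ := fun t => ∫ s in c..t, g s with hF
  have hFc : ContinuousOn F (Set.Icc c τ) := by
    have := intervalIntegral.continuousOn_primitive_interval' hg (Set.left_mem_uIcc)
    rwa [Set.uIcc_of_le hcτ] at this
  have hFsub : ∀ p ∈ Set.Icc c τ, ∀ q ∈ Set.Icc c τ, ∫ s in p..q, g s = F q - F p := by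
    intro p hp q hq
    have h1 : IntervalIntegrable g volume c p :=
      hg.mono_set (by
        rw [Set.uIcc_of_le hcτ, Set.uIcc_of_le hp.1]
        exact Set.Icc_subset_Icc_right hp.2)
    have h2 : IntervalIntegrable g volume c q :=
      hg.mono_set (by
        rw [Set.uIcc_of_le hcτ, Set.uIcc_of_le hq.1]
        exact Set.Icc_subset_Icc_right hq.2)
    exact (intervalIntegral.integral_interval_sub_left h2 h1).symm
  have hder := hg.ae_hasDerivAt_integral
  rw [Set.uIcc_of_le hcτ] at hder
  -- The primitive has equal values at the ends of each component of `E`, so `g` has mean zero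
  -- there; off `E` the primitive is at a running minimum, so `g ≤ 0` almost everywhere.
  set E : Set ℝ := {t | t ∈ Set.Ioo c τ ∧ ∃ s ∈ Set.Icc c t, F s < F t} with hE
  have hEo : IsOpen E := by
    rw [isOpen_iff_mem_nhds]
    rintro t ⟨ht, s, hs, hst⟩
    have hcont : ContinuousAt F t := hFc.continuousAt (Icc_mem_nhds ht.1 ht.2)
    have hst' : s < t := lt_of_le_of_ne hs.2 fun h => by simp [h] at hst
    filter_upwards [Ioo_mem_nhds ht.1 ht.2, hcont.eventually (lt_mem_nhds hst),
      lt_mem_nhds hst'] with y hy1 hy2 hy3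
    exact ⟨hy1, s, ⟨hs.1, hy3.le⟩, hy2⟩
  have hEsub : E ⊆ Set.Ioo c τ := fun t ht => ht.1
  have hkI : IntegrableOn k (Set.Ioo c τ) :=
    ((intervalIntegrable_iff_integrableOn_Ioo_of_le hcτ).1 hk)
  -- The minimality of the primitive at `τ` is used only here, for a component of `E` that ends at
  -- `τ`.
  have hnotE : ∀ t ∈ Set.Icc c τ, t ∉ E → ∀ s ∈ Set.Icc c t, F t ≤ F s := by
    intro t ht htE s hs
    rcases eq_or_lt_of_le ht.1 with rfl | h1
    · rw [le_antisymm hs.2 hs.1]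
    rcases eq_or_lt_of_le ht.2 with rfl | h2
    · exact hmin s hs
    by_contra! hlt
    exact htE ⟨⟨h1, h2⟩, s, hs, hlt⟩
  have hfirst : 0 ≤ ∫ s in E, k s := by
    refine setIntegral_nonneg_of_components hEo (hEsub.trans Set.Ioo_subset_Icc_self)
      (hkI.mono_set hEsub) ?_
    intro p q hpq hsub hp hq
    have hcl : Set.Icc p q ⊆ Set.Icc c τ := by
      rw [← closure_Ioo hpq.ne]
      exact closure_minimal (hsub.trans (hEsub.trans Set.Ioo_subset_Icc_self)) isClosed_Icc
    have hpI := hcl (Set.left_mem_Icc.2 hpq.le)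
    have hqI := hcl (Set.right_mem_Icc.2 hpq.le)
    rw [← integral_Ioc_eq_integral_Ioo, ← intervalIntegral.integral_of_le hpq.le]
    apply h p q hpI.1 hpq hqI.2
    rw [hFsub p hpI q hqI, sub_eq_zero]
    refine le_antisymm (hnotE q hqI hq p ⟨hpI.1, hpq.le⟩) ?_
    -- A minimum point of `F` on `[c, t]` is not in `E`, hence lies at or to the left of `p`; there
    -- `F` is at least `F p`, because `p ∉ E`.
    have hge : ∀ t ∈ Set.Ioo p q, F p ≤ F t := by
      intro t ht
      have htI := hcl (Set.Ioo_subset_Icc_self ht)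
      obtain ⟨m, hm, hmin'⟩ := isCompact_Icc.exists_isMinOn (Set.nonempty_Icc.2 htI.1)
        (hFc.mono (Set.Icc_subset_Icc_right htI.2))
      have hmE : m ∉ E := by
        rintro ⟨-, s, hs, hlt⟩
        exact absurd (hmin' (show s ∈ Set.Icc c t from ⟨hs.1, hs.2.trans hm.2⟩)) (not_le.2 hlt)
      have hmp : m ≤ p := by
        by_contra! hlt
        exact hmE (hsub ⟨hlt, hm.2.trans_lt ht.2⟩)
      exact (hnotE p hpI hp m ⟨hm.1, hmp⟩).trans (hmin' (Set.right_mem_Icc.2 htI.1))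
    have hcw : ContinuousWithinAt F (Set.Ioo p q) q :=
      (hFc q hqI).mono (Set.Ioo_subset_Icc_self.trans hcl)
    have : (nhdsWithin q (Set.Ioo p q)).NeBot := by
      rw [← mem_closure_iff_nhdsWithin_neBot, closure_Ioo hpq.ne]
      exact Set.right_mem_Icc.2 hpq.le
    exact ge_of_tendsto hcw (Filter.eventually_of_mem self_mem_nhdsWithin hge)
  have hsecond : 0 ≤ ∫ s in Set.Ioo c τ \ E, k s := by
    refine setIntegral_nonneg_of_ae_restrict ?_
    rw [Filter.EventuallyLE, ae_restrict_iff' (measurableSet_Ioo.diff hEo.measurableSet)]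
    filter_upwards [hder] with t ht hmem
    apply hneg
    have hd : HasDerivAt F (g t) t :=
      ht (Set.Ioo_subset_Icc_self hmem.1) c (Set.left_mem_Icc.2 hcτ)
    have hmono := hnotE t (Set.Ioo_subset_Icc_self hmem.1) hmem.2
    have hslope := (hasDerivAt_iff_tendsto_slope.1 hd).mono_left
      (nhdsWithin_mono t (fun y (hy : y ∈ Set.Iio t) => ne_of_lt hy))
    refine le_of_tendsto hslope ?_
    filter_upwards [Ioo_mem_nhdsLT hmem.1.1] with y hy
    rw [slope_def_field]
    exact div_nonpos_of_nonneg_of_nonpos (sub_nonneg.2 (hmono y ⟨hy.1.le, hy.2.le⟩))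
      (sub_nonpos.2 hy.2.le)
  rw [intervalIntegral.integral_of_le hcτ, integral_Ioc_eq_integral_Ioo,
    ← integral_inter_add_sdiff hEo.measurableSet hkI, Set.inter_eq_right.2 hEsub]
  exact add_nonneg hfirst hsecond

/-- A growth lemma of rising sun type: if `g` has nonpositive integral over `[c, d]`, the integral
of `k` is nonnegative over all subintervals on which `g` has mean zero, and `k ≥ 0` where `g ≤ 0`,
then the integral of `k` over `[c, d]` is nonnegative. -/
theorem integral_nonneg_of_integral_nonpos {g k : ℝ → ℝ} {c d : ℝ} (hcd : c ≤ d)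
    (hg : IntervalIntegrable g volume c d) (hk : IntervalIntegrable k volume c d)
    (h0 : ∫ s in c..d, g s ≤ 0)
    (h : ∀ p q, c ≤ p → p < q → q ≤ d → ∫ s in p..q, g s = 0 → 0 ≤ ∫ s in p..q, k s)
    (hneg : ∀ s, g s ≤ 0 → 0 ≤ k s) : 0 ≤ ∫ s in c..d, k s := by
  set F : ℝ → ℝ := fun t => ∫ s in c..t, g s with hF
  have hFc : ContinuousOn F (Set.Icc c d) := by
    have := intervalIntegral.continuousOn_primitive_interval' hg (Set.left_mem_uIcc)
    rwa [Set.uIcc_of_le hcd] at this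
  have hcomp : IsCompact (Set.Icc c d ∩ F ⁻¹' Set.Iic (F d)) :=
    isCompact_Icc.of_isClosed_subset (hFc.preimage_isClosed_of_isClosed isClosed_Icc isClosed_Iic)
      Set.inter_subset_left
  -- `τ` is the first point where the primitive is at most `F d`: the previous lemma applies on `[c,
  -- τ]`, and `g` has mean zero on `[τ, d]`.
  obtain ⟨τ, ⟨hτ, hτd⟩, hleast⟩ :=
    hcomp.exists_isLeast ⟨d, Set.right_mem_Icc.2 hcd, le_refl (F d)⟩
  have hbefore : ∀ t ∈ Set.Ico c τ, F d < F t := by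
    intro t ht
    by_contra! hle
    exact absurd (hleast ⟨⟨ht.1, ht.2.le.trans hτ.2⟩, hle⟩) (not_le.2 ht.2)
  have hFτ : F τ = F d := by
    refine le_antisymm hτd ?_
    rcases eq_or_lt_of_le hτ.1 with h1 | h1
    · rw [← h1]
      simpa [hF] using h0
    · have hcw : ContinuousWithinAt F (Set.Ico c τ) τ :=
        (hFc τ hτ).mono (fun t ht => ⟨ht.1, ht.2.le.trans hτ.2⟩)
      have : (nhdsWithin τ (Set.Ico c τ)).NeBot := by
        rw [← mem_closure_iff_nhdsWithin_neBot, closure_Ico h1.ne]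
        exact Set.right_mem_Icc.2 h1.le
      exact ge_of_tendsto hcw
        (Filter.eventually_of_mem self_mem_nhdsWithin fun t ht => (hbefore t ht).le)
  have hsub1 : Set.uIcc c τ ⊆ Set.uIcc c d := by
    rw [Set.uIcc_of_le hcd, Set.uIcc_of_le hτ.1]; exact Set.Icc_subset_Icc_right hτ.2
  have hsub2 : Set.uIcc τ d ⊆ Set.uIcc c d := by
    rw [Set.uIcc_of_le hcd, Set.uIcc_of_le hτ.2]; exact Set.Icc_subset_Icc_left hτ.1
  rw [← intervalIntegral.integral_add_adjacent_intervals (hk.mono_set hsub1) (hk.mono_set hsub2)]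
  refine add_nonneg ?_ ?_
  · refine integral_nonneg_of_primitive_min_right hτ.1 (hg.mono_set hsub1) (hk.mono_set hsub1) ?_
      (fun p q hp hpq hq => h p q hp hpq (hq.trans hτ.2)) hneg
    intro t ht
    rcases eq_or_lt_of_le ht.2 with rfl | h1
    · exact le_rfl
    · exact hτd.trans (hbefore t ⟨ht.1, h1⟩).le
  · rcases eq_or_lt_of_le hτ.2 with h1 | h1
    · simp [h1]
    · refine h τ d hτ.1 h1 le_rfl ?_
      rw [← intervalIntegral.integral_interval_sub_left hg (hg.mono_set hsub1)]
      exact sub_eq_zero.2 hFτ.symm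

/-! ### Unit oscillation, level indicators and second moments -/

/-- `φ` is square integrable on `[a, b]` and its variance on every subinterval is at most `1`. -/
structure UnitOscillation (a b : ℝ) (φ : ℝ → ℝ) : Prop where
  int : IntervalIntegrable φ volume a b
  sq : IntervalIntegrable (fun s => φ s ^ 2) volume a b
  var : ∀ p q, a ≤ p → p < q → q ≤ b → ∃ w, ∫ s in p..q, (φ s - w) ^ 2 ≤ q - p

/-- The indicator of the half-line `[l, ∞)`. -/
noncomputable def levelIndicator (l : ℝ) : ℝ → ℝ := Set.indicator (Set.Ici l) 1

theorem levelIndicator_nonneg (l x : ℝ) : 0 ≤ levelIndicator l x :=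
  Set.indicator_nonneg (fun _ _ => zero_le_one) x

theorem levelIndicator_le_one (l x : ℝ) : levelIndicator l x ≤ 1 :=
  Set.indicator_le_self' (fun _ _ => zero_le_one) x

theorem levelIndicator_of_le {l x : ℝ} (h : l ≤ x) : levelIndicator l x = 1 :=
  Set.indicator_of_mem (Set.mem_Ici.2 h) _

theorem levelIndicator_of_lt {l x : ℝ} (h : x < l) : levelIndicator l x = 0 :=
  Set.indicator_of_notMem (fun h' => absurd h (not_lt.2 h')) _

theorem measurable_levelIndicator (l : ℝ) : Measurable (levelIndicator l) :=
  measurable_one.indicator measurableSet_Ici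

theorem intervalIntegrable_levelIndicator {φ : ℝ → ℝ} {a b : ℝ}
    (hφ : IntervalIntegrable φ volume a b) (l : ℝ) :
    IntervalIntegrable (fun s => levelIndicator l (φ s)) volume a b := by
  have key : ∀ {c d : ℝ}, IntegrableOn φ (Set.Ioc c d) →
      IntegrableOn (fun s => levelIndicator l (φ s)) (Set.Ioc c d) := by
    intro c d h
    refine Integrable.of_bound
      ((measurable_levelIndicator l).comp_aemeasurable h.aemeasurable).aestronglyMeasurable 1
      (Filter.Eventually.of_forall fun s => ?_)
    rw [Real.norm_eq_abs, abs_of_nonneg (levelIndicator_nonneg _ _)]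
    exact levelIndicator_le_one _ _
  exact ⟨key hφ.1, key hφ.2⟩

theorem intervalIntegrable_mono_Icc {f : ℝ → ℝ} {a b p q : ℝ}
    (hf : IntervalIntegrable f volume a b) (hp : a ≤ p) (hpq : p ≤ q) (hq : q ≤ b) :
    IntervalIntegrable f volume p q :=
  hf.mono_set (by
    rw [Set.uIcc_of_le hpq, Set.uIcc_of_le (hp.trans (hpq.trans hq))]
    exact Set.Icc_subset_Icc hp hq)

theorem intervalIntegrable_sub_sq {φ : ℝ → ℝ} {p q : ℝ} (h1 : IntervalIntegrable φ volume p q)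
    (h2 : IntervalIntegrable (fun s => φ s ^ 2) volume p q) (w : ℝ) :
    IntervalIntegrable (fun s => (φ s - w) ^ 2) volume p q := by
  have : (fun s => (φ s - w) ^ 2) = fun s => φ s ^ 2 - 2 * w * φ s + w ^ 2 := by
    funext s; ring
  rw [this]
  exact (h2.sub (h1.const_mul _)).add intervalIntegrable_const

theorem integral_sub_sq {φ : ℝ → ℝ} {p q : ℝ} (h1 : IntervalIntegrable φ volume p q)
    (h2 : IntervalIntegrable (fun s => φ s ^ 2) volume p q) (w : ℝ) :
    ∫ s in p..q, (φ s - w) ^ 2 =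
      (∫ s in p..q, φ s ^ 2) - 2 * w * (∫ s in p..q, φ s) + w ^ 2 * (q - p) := by
  have : (fun s => (φ s - w) ^ 2) = fun s => φ s ^ 2 - 2 * w * φ s + w ^ 2 := by
    funext s; ring
  rw [this, intervalIntegral.integral_add (h2.sub (h1.const_mul _)) intervalIntegrable_const,
    intervalIntegral.integral_sub h2 (h1.const_mul _), intervalIntegral.integral_const_mul,
    intervalIntegral.integral_const, smul_eq_mul]
  ring

/-- The mean is the best constant approximation in mean square. -/
theorem integral_sub_mean_sq_le {φ : ℝ → ℝ} {p q m : ℝ} (hpq : p ≤ q)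
    (h1 : IntervalIntegrable φ volume p q)
    (h2 : IntervalIntegrable (fun s => φ s ^ 2) volume p q)
    (hm : ∫ s in p..q, φ s = m * (q - p)) (w : ℝ) :
    ∫ s in p..q, (φ s - m) ^ 2 ≤ ∫ s in p..q, (φ s - w) ^ 2 := by
  rw [integral_sub_sq h1 h2, integral_sub_sq h1 h2, hm]
  nlinarith [mul_nonneg (sq_nonneg (m - w)) (sub_nonneg.2 hpq)]

theorem UnitOscillation.variance_le {a b : ℝ} {φ : ℝ → ℝ} (h : UnitOscillation a b φ) {p q m : ℝ}
    (hp : a ≤ p) (hpq : p < q) (hq : q ≤ b) (hm : ∫ s in p..q, φ s = m * (q - p)) :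
    ∫ s in p..q, (φ s - m) ^ 2 ≤ q - p := by
  obtain ⟨w, hw⟩ := h.var p q hp hpq hq
  exact (integral_sub_mean_sq_le hpq.le (intervalIntegrable_mono_Icc h.int hp hpq.le hq)
    (intervalIntegrable_mono_Icc h.sq hp hpq.le hq) hm w).trans hw

/-! ### Exponential decay of level sets -/

/-- Passing from the centre `w` to the centre `w + h` on an interval of mean `w + 1`. -/
theorem shifted_second_moment_le {A Q h : ℝ} (hh0 : 0 ≤ h) (hh : h ≤ 1 / 2) (hA0 : 0 ≤ A)
    (hA : A ≤ 2 * Q) : A - 2 * h * Q + h ^ 2 * Q ≤ (1 + 2 * h ^ 2) * Real.exp (-h) * A := by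
  have hexp : 1 - h ≤ Real.exp (-h) := by linarith [Real.add_one_le_exp (-h)]
  have h1 : (1 + 2 * h ^ 2) * (1 - h) * A ≤ (1 + 2 * h ^ 2) * Real.exp (-h) * A := by gcongr
  refine le_trans ?_ h1
  -- After `exp (-h)` is replaced by `1 - h`, the claim reads `(h - 2h² + 2h³) A ≤ (2h - h²) Q`.
  -- Inserting `A ≤ 2Q` leaves the slack `h² (3 - 4h) Q`.
  have hc : 0 ≤ h - 2 * h ^ 2 + 2 * h ^ 3 := by nlinarith [pow_nonneg hh0 3]
  have hQ : 0 ≤ Q := by linarith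
  have h2 := mul_le_mul_of_nonneg_left hA hc
  have h3 : 0 ≤ Q * (h ^ 2 * (3 - 4 * h)) :=
    mul_nonneg hQ (mul_nonneg (sq_nonneg h) (by linarith))
  nlinarith

/-- Induction on the number of steps of length `h`, for all centres and subintervals at once.
Chebyshev at distance 2 starts it and gives the factor `1/4`. In the inductive step the rising sun
lemma reduces to intervals of mean exactly `w + 1`, where moving the centre to `w + h` gains the
factor `(1 + 2h²) e^{-h}`. -/
theorem UnitOscillation.integral_levelIndicator_le_pow {a b : ℝ} {φ : ℝ → ℝ}
    (H : UnitOscillation a b φ) {h : ℝ} (hh0 : 0 ≤ h) (hh : h ≤ 1 / 2) (n : ℕ) :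
    ∀ w c d, a ≤ c → c ≤ d → d ≤ b → ∫ s in c..d, φ s ≤ (w + 1) * (d - c) →
      ∫ s in c..d, levelIndicator (w + n * h + 2) (φ s) ≤
        1 / 4 * ((1 + 2 * h ^ 2) * Real.exp (-h)) ^ n * ∫ s in c..d, (φ s - w) ^ 2 := by
  induction n with
  | zero =>
    intro w c d hc hcd hd _
    have h1 := intervalIntegrable_mono_Icc H.int hc hcd hd
    have h2 := intervalIntegrable_mono_Icc H.sq hc hcd hd
    rw [pow_zero, mul_one, ← intervalIntegral.integral_const_mul]
    refine intervalIntegral.integral_mono_on hcd (intervalIntegrable_levelIndicator h1 _)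
      ((intervalIntegrable_sub_sq h1 h2 w).const_mul _) fun s _ => ?_
    rcases le_or_gt (w + ((0 : ℕ) : ℝ) * h + 2) (φ s) with hs | hs
    · rw [levelIndicator_of_le hs]
      push_cast at hs
      nlinarith
    · rw [levelIndicator_of_lt hs]
      positivity
  | succ n ih =>
    intro w c d hc hcd hd hmean
    set lev : ℝ := w + ((n + 1 : ℕ) : ℝ) * h + 2 with hlev
    have hlev1 : w + 1 < lev := by
      have : 0 ≤ ((n + 1 : ℕ) : ℝ) * h := by positivity
      linarith
    have hlev2 : w + h + n * h + 2 = lev := by rw [hlev]; push_cast; ring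
    set ρ : ℝ := (1 + 2 * h ^ 2) * Real.exp (-h) with hρ
    have hρ0 : 0 ≤ ρ := by positivity
    have h1 := intervalIntegrable_mono_Icc H.int hc hcd hd
    have h2 := intervalIntegrable_mono_Icc H.sq hc hcd hd
    have hK := (intervalIntegrable_sub_sq h1 h2 w).const_mul (1 / 4 * ρ ^ (n + 1))
    have hL := intervalIntegrable_levelIndicator h1 lev
    have hmain : 0 ≤ ∫ s in c..d,
        (1 / 4 * ρ ^ (n + 1) * (φ s - w) ^ 2 - levelIndicator lev (φ s)) := by
      refine integral_nonneg_of_integral_nonpos (g := fun s => φ s - (w + 1)) hcd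
        (h1.sub intervalIntegrable_const) (hK.sub hL) ?_ ?_ ?_
      · rw [intervalIntegral.integral_sub h1 intervalIntegrable_const,
          intervalIntegral.integral_const, smul_eq_mul]
        linarith
      · intro p q hp hpq hq hpq0
        have hp' := hc.trans hp
        have hq' := hq.trans hd
        have g1 := intervalIntegrable_mono_Icc h1 hp hpq.le hq
        have g2 := intervalIntegrable_mono_Icc h2 hp hpq.le hq
        rw [intervalIntegral.integral_sub g1 intervalIntegrable_const,
          intervalIntegral.integral_const, smul_eq_mul] at hpq0
        have hm : ∫ s in p..q, φ s = (w + 1) * (q - p) := by linarith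
        have hvar := H.variance_le hp' hpq hq' hm
        -- The mean `w + 1` is at most `(w + h) + 1`, so the mean condition survives the shift of
        -- the centre.
        have hih := ih (w + h) p q hp' hpq.le hq' (by rw [hm]; nlinarith)
        rw [hlev2] at hih
        rw [intervalIntegral.integral_sub (intervalIntegrable_mono_Icc hK hp hpq.le hq)
          (intervalIntegrable_mono_Icc hL hp hpq.le hq), intervalIntegral.integral_const_mul]
        have e0 := integral_sub_sq g1 g2 w
        have e1 := integral_sub_sq g1 g2 (w + 1)
        have e2 := integral_sub_sq g1 g2 (w + h)
        have hA0 : 0 ≤ ∫ s in p..q, (φ s - w) ^ 2 :=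
          intervalIntegral.integral_nonneg hpq.le fun s _ => sq_nonneg _
        rw [hm] at e0 e1 e2
        -- The second moment about `w` is the variance, at most `q - p`, plus the squared offset `1`
        -- of the mean times `q - p`; hence `A ≤ 2Q`.
        have hstep := shifted_second_moment_le hh0 hh hA0 (Q := q - p) (by nlinarith)
        have hle : ∫ s in p..q, (φ s - (w + h)) ^ 2 ≤ ρ * ∫ s in p..q, (φ s - w) ^ 2 := by
          refine le_trans (le_of_eq ?_) hstep
          rw [e0, e2]
          ring
        have hfin := mul_le_mul_of_nonneg_left hle (show 0 ≤ 1 / 4 * ρ ^ n by positivity)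
        rw [pow_succ]
        linarith
      · intro s hs
        rw [levelIndicator_of_lt (by linarith), sub_zero]
        positivity
    rw [intervalIntegral.integral_sub hK hL, intervalIntegral.integral_const_mul] at hmain
    linarith

/-- Exponential decay of the upper level sets of a function of unit oscillation, measured against
the second moment about `w`. -/
theorem UnitOscillation.integral_levelIndicator_le {a b : ℝ} {φ : ℝ → ℝ}
    (H : UnitOscillation a b φ) {u w : ℝ} (hu : 0 ≤ u) (hab : a ≤ b)
    (hmean : ∫ s in a..b, φ s ≤ (w + 1) * (b - a)) :
    ∫ s in a..b, levelIndicator (w + u + 2) (φ s) ≤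
      1 / 4 * Real.exp (-u) * ∫ s in a..b, (φ s - w) ^ 2 := by
  have hA0 : 0 ≤ ∫ s in a..b, (φ s - w) ^ 2 :=
    intervalIntegral.integral_nonneg hab fun s _ => sq_nonneg _
  -- With `h = u / n` the accumulated error `(1 + 2u²/n²)^n ≤ exp (2u²/n)` tends to 1.
  have hlim : Filter.Tendsto (fun n : ℕ => 1 / 4 * (Real.exp (2 * u ^ 2 / n) * Real.exp (-u)) *
      ∫ s in a..b, (φ s - w) ^ 2) Filter.atTop
      (nhds (1 / 4 * (Real.exp 0 * Real.exp (-u)) * ∫ s in a..b, (φ s - w) ^ 2)) := by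
    have h0 : Filter.Tendsto (fun n : ℕ => 2 * u ^ 2 / (n : ℝ)) Filter.atTop (nhds 0) :=
      tendsto_const_div_atTop_nhds_zero_nat _
    exact (((Real.continuous_exp.tendsto 0).comp h0).mul_const _).const_mul _ |>.mul_const _
  rw [Real.exp_zero, one_mul] at hlim
  refine ge_of_tendsto hlim ?_
  obtain ⟨N, hN⟩ := exists_nat_ge (2 * u)
  filter_upwards [Filter.eventually_ge_atTop (max N 1)] with n hn
  have hn1 : (1 : ℝ) ≤ n := by exact_mod_cast (le_max_right N 1).trans hn
  have hnN : 2 * u ≤ n := hN.trans (by exact_mod_cast (le_max_left N 1).trans hn)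
  have hn0 : (0 : ℝ) < n := by linarith
  have hstep := H.integral_levelIndicator_le_pow (h := u / n) (by positivity)
    (by rw [div_le_iff₀ hn0]; linarith) n w a b le_rfl hab le_rfl hmean
  rw [mul_div_cancel₀ u hn0.ne'] at hstep
  refine hstep.trans (mul_le_mul_of_nonneg_right (mul_le_mul_of_nonneg_left ?_ (by norm_num)) hA0)
  rw [mul_pow, ← Real.exp_nat_mul]
  have e1 : (n : ℝ) * -(u / n) = -u := by field_simp
  rw [e1]
  refine mul_le_mul_of_nonneg_right ?_ (Real.exp_pos _).le
  calc (1 + 2 * (u / n) ^ 2) ^ n ≤ Real.exp (2 * (u / n) ^ 2) ^ n := by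
        gcongr
        linarith [Real.add_one_le_exp (2 * (u / n) ^ 2)]
    _ = Real.exp (2 * u ^ 2 / n) := by
        rw [← Real.exp_nat_mul]
        congr 1
        field_simp

/-- Truncation is 1-Lipschitz, so the truncated centre `max w 0` serves for the truncated function.
-/
theorem UnitOscillation.posPart {a b : ℝ} {φ : ℝ → ℝ} (H : UnitOscillation a b φ) :
    UnitOscillation a b (fun s => max (φ s) 0) := by
  have h1 : IntervalIntegrable (fun s => max (φ s) 0) volume a b := 
    ⟨H.int.1.pos_part, H.int.2.pos_part⟩
  have h2 : IntervalIntegrable (fun s => max (φ s) 0 ^ 2) volume a b := by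
    refine H.sq.mono_fun' ?_ (Filter.Eventually.of_forall fun s => ?_)
    · exact h1.def'.aestronglyMeasurable.pow 2
    · simp only
      rw [Real.norm_eq_abs, abs_of_nonneg (sq_nonneg _)]
      rcases le_total (φ s) 0 with h | h
      · rw [max_eq_right h]; nlinarith [sq_nonneg (φ s)]
      · rw [max_eq_left h]
  refine ⟨h1, h2, fun p q hp hpq hq => ?_⟩
  obtain ⟨w, hw⟩ := H.var p q hp hpq hq
  refine ⟨max w 0, le_trans ?_ hw⟩
  refine intervalIntegral.integral_mono_on hpq.le
    (intervalIntegrable_sub_sq (intervalIntegrable_mono_Icc h1 hp hpq.le hq)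
      (intervalIntegrable_mono_Icc h2 hp hpq.le hq) _)
    (intervalIntegrable_sub_sq (intervalIntegrable_mono_Icc H.int hp hpq.le hq)
      (intervalIntegrable_mono_Icc H.sq hp hpq.le hq) _) fun s _ => ?_
  exact sq_le_sq.2 (abs_max_sub_max_le_abs _ _ _)

theorem UnitOscillation.neg {a b : ℝ} {φ : ℝ → ℝ} (H : UnitOscillation a b φ) :
    UnitOscillation a b (fun s => -φ s) := by
  refine ⟨H.int.neg, by simpa using H.sq, fun p q hp hpq hq => ?_⟩
  obtain ⟨w, hw⟩ := H.var p q hp hpq hq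
  refine ⟨-w, le_of_eq_of_le ?_ hw⟩
  congr 1
  funext s
  ring

theorem UnitOscillation.integral_sq_le {a b : ℝ} {φ : ℝ → ℝ} (hab : a < b)
    (H : UnitOscillation a b φ) (hmean : ∫ s in a..b, φ s = 0) :
    ∫ s in a..b, φ s ^ 2 ≤ b - a := by
  simpa using H.variance_le (m := 0) le_rfl hab le_rfl (by simpa using hmean)

theorem UnitOscillation.integral_levelIndicator_posPart_le {a b : ℝ} {φ : ℝ → ℝ} (hab : a < b)
    (H : UnitOscillation a b φ) (hmean : ∫ s in a..b, φ s = 0) {u : ℝ} (hu : 0 ≤ u) :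
    ∫ s in a..b, levelIndicator (u + 2) (max (φ s) 0) ≤
      1 / 4 * Real.exp (-u) * ∫ s in a..b, max (φ s) 0 ^ 2 := by
  have hP := H.posPart
  have h1 : ∫ s in a..b, max (φ s) 0 ≤ (0 + 1) * (b - a) := by
    -- The bound `φ⁺ ≤ (φ² + 1) / 2` shows that the mean of the positive part is at most 1, as
    -- needed for the centre `w = 0`.
    have : ∫ s in a..b, max (φ s) 0 ≤ ∫ s in a..b, (1 / 2 * φ s ^ 2 + 1 / 2) := by
      refine intervalIntegral.integral_mono_on hab.le hP.int
        ((H.sq.const_mul _).add intervalIntegrable_const) fun s _ => ?_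
      rcases le_total (φ s) 0 with h | h
      · rw [max_eq_right h]; positivity
      · rw [max_eq_left h]; nlinarith [sq_nonneg (φ s - 1)]
    rw [intervalIntegral.integral_add (H.sq.const_mul _) intervalIntegrable_const,
      intervalIntegral.integral_const_mul, intervalIntegral.integral_const, smul_eq_mul] at this
    linarith [H.integral_sq_le hab hmean]
  simpa using hP.integral_levelIndicator_le hu hab.le h1

/-- Exponential decay of the tail of a function of unit oscillation and mean zero. -/
theorem UnitOscillation.integral_levelIndicator_abs_le {a b : ℝ} {φ : ℝ → ℝ} (hab : a < b)
    (H : UnitOscillation a b φ) (hmean : ∫ s in a..b, φ s = 0) {u : ℝ} (hu : 0 ≤ u) :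
    ∫ s in a..b, levelIndicator (u + 2) |φ s| ≤ 1 / 4 * Real.exp (-u) * (b - a) := by
  have hn := H.neg
  have hmean' : ∫ s in a..b, -φ s = 0 := by rw [intervalIntegral.integral_neg, hmean, neg_zero]
  have hP := H.posPart
  have hN := hn.posPart
  have t1 := H.integral_levelIndicator_posPart_le hab hmean hu
  have t2 := hn.integral_levelIndicator_posPart_le hab hmean' hu
  have hsplit : ∫ s in a..b, levelIndicator (u + 2) |φ s| =
      (∫ s in a..b, levelIndicator (u + 2) (max (φ s) 0)) +
        ∫ s in a..b, levelIndicator (u + 2) (max (-φ s) 0) := by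
    rw [← intervalIntegral.integral_add (intervalIntegrable_levelIndicator hP.int _)
      (intervalIntegrable_levelIndicator hN.int _)]
    congr 1
    funext s
    have h0 : levelIndicator (u + 2) 0 = 0 := levelIndicator_of_lt (by linarith)
    rcases le_total (φ s) 0 with h | h
    · rw [max_eq_right h, max_eq_left (by linarith), abs_of_nonpos h, h0, zero_add]
    · rw [max_eq_left h, max_eq_right (by linarith), abs_of_nonneg h, h0, add_zero]
  have hsq : (∫ s in a..b, max (φ s) 0 ^ 2) + ∫ s in a..b, max (-φ s) 0 ^ 2 =
      ∫ s in a..b, φ s ^ 2 := by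
    rw [← intervalIntegral.integral_add hP.sq hN.sq]
    congr 1
    funext s
    rcases le_total (φ s) 0 with h | h
    · rw [max_eq_right h, max_eq_left (by linarith)]; ring
    · rw [max_eq_left h, max_eq_right (by linarith)]; ring
  rw [hsplit]
  have := H.integral_sq_le hab hmean
  have hc : 0 ≤ 1 / 4 * Real.exp (-u) := by positivity
  nlinarith

/-- Chebyshev's inequality for a function of unit oscillation and mean zero. -/
theorem UnitOscillation.sq_mul_integral_levelIndicator_abs_le {a b : ℝ} {φ : ℝ → ℝ} (hab : a < b)
    (H : UnitOscillation a b φ) (hmean : ∫ s in a..b, φ s = 0) {t : ℝ} (ht : 0 ≤ t) :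
    t ^ 2 * ∫ s in a..b, levelIndicator t |φ s| ≤ b - a := by
  refine le_trans ?_ (H.integral_sq_le hab hmean)
  rw [← intervalIntegral.integral_const_mul]
  refine intervalIntegral.integral_mono_on hab.le
    ((intervalIntegrable_levelIndicator H.int.abs _).const_mul _) H.sq fun s _ => ?_
  rcases le_or_gt t |φ s| with h | h
  · rw [levelIndicator_of_le h, mul_one, ← sq_abs (φ s)]
    gcongr
  · rw [levelIndicator_of_lt h, mul_zero]
    positivity

/-! ### From the BMO norm to unit oscillation; upper bounds for the tail -/

theorem intervalAvg_eq {c d : ℝ} (hcd : c ≤ d) (φ : ℝ → ℝ) :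
    intervalAvg c d φ = (d - c)⁻¹ * ∫ s in c..d, φ s := by
  rw [intervalAvg, intervalIntegral.integral_of_le hcd, integral_Icc_eq_integral_Ioc]

theorem integral_eq_intervalAvg_mul {c d : ℝ} (hcd : c < d) (φ : ℝ → ℝ) :
    ∫ s in c..d, φ s = intervalAvg c d φ * (d - c) := by
  rw [intervalAvg_eq hcd.le]
  field_simp [(sub_pos.2 hcd).ne']

theorem intervalIntegrable_iff_integrableOn_Icc {c d : ℝ} (hcd : c ≤ d) (φ : ℝ → ℝ) :
    IntervalIntegrable φ volume c d ↔ IntegrableOn φ (Set.Icc c d) := by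
  rw [intervalIntegrable_iff_integrableOn_Ioc_of_le hcd, integrableOn_Icc_iff_integrableOn_Ioc]

/-- The least constant in the definition of `bmoNorm` is attained. -/
theorem hasOscillationBound_bmoNorm {a b : ℝ} {φ : ℝ → ℝ} (hφ : φ ∈ BMO a b) :
    HasOscillationBound a b φ (bmoNorm a b φ) := by
  obtain ⟨C₀, hC₀, h₀⟩ := hφ
  have hne : {C : ℝ | 0 ≤ C ∧ HasOscillationBound a b φ C}.Nonempty := ⟨C₀, hC₀, h₀⟩
  refine ⟨h₀.1, fun c d hc hcd hd => ⟨(h₀.2 c d hc hcd hd).1, ?_⟩⟩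
  have hlim : Filter.Tendsto (fun C : ℝ => C ^ 2)
      (nhdsWithin (bmoNorm a b φ) (Set.Ioi (bmoNorm a b φ))) (nhds (bmoNorm a b φ ^ 2)) :=
    ((continuous_pow 2).tendsto _).mono_left nhdsWithin_le_nhds
  refine ge_of_tendsto hlim ?_
  filter_upwards [self_mem_nhdsWithin] with C hC
  obtain ⟨C', ⟨hC'0, hC'⟩, hlt⟩ := exists_lt_of_csInf_lt hne hC
  exact ((hC'.2 c d hc hcd hd).2).trans (pow_le_pow_left₀ hC'0 hlt.le 2)

theorem bmoNorm_nonneg (a b : ℝ) (φ : ℝ → ℝ) : 0 ≤ bmoNorm a b φ :=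
  Real.sInf_nonneg fun _ h => h.1

theorem HasOscillationBound.mem_BMOBall {a b ε : ℝ} {φ : ℝ → ℝ} (hε : 0 ≤ ε)
    (h : HasOscillationBound a b φ ε) : φ ∈ BMOBall a b ε :=
  ⟨⟨ε, hε, h⟩, csInf_le ⟨0, fun _ h => h.1⟩ ⟨hε, h⟩⟩

theorem HasOscillationBound.mono {a b C D : ℝ} {φ : ℝ → ℝ} (h : HasOscillationBound a b φ C)
    (hC : 0 ≤ C) (hCD : C ≤ D) : HasOscillationBound a b φ D :=
  ⟨h.1, fun c d hc hcd hd => ⟨(h.2 c d hc hcd hd).1,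
    ((h.2 c d hc hcd hd).2).trans (pow_le_pow_left₀ hC hCD 2)⟩⟩

theorem hasOscillationBound_of_mem_BMOBall {a b ε : ℝ} {φ : ℝ → ℝ}
    (h : φ ∈ BMOBall a b ε) : HasOscillationBound a b φ ε :=
  (hasOscillationBound_bmoNorm h.1).mono (bmoNorm_nonneg _ _ _) h.2

/-- Normalization of a function with an oscillation bound. -/
theorem HasOscillationBound.unitOscillation {a b ε : ℝ} (hab : a < b) (hε : 0 < ε) {φ : ℝ → ℝ}
    (h : HasOscillationBound a b φ ε) (m : ℝ) :
    UnitOscillation a b (fun s => (φ s - m) / ε) := by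
  have h1 : IntervalIntegrable φ volume a b :=
    (intervalIntegrable_iff_integrableOn_Icc hab.le φ).2 h.1
  have h1' : IntervalIntegrable (fun s => φ s - intervalAvg a b φ) volume a b :=
    h1.sub intervalIntegrable_const
  have h2 : IntervalIntegrable (fun s => (φ s - intervalAvg a b φ) ^ 2) volume a b := by
    have := (h.2 a b le_rfl hab le_rfl).1
    simp only [sq_abs] at this
    exact (intervalIntegrable_iff_integrableOn_Icc hab.le _).2 this
  have h3 : IntervalIntegrable (fun s => (φ s - m) ^ 2) volume a b := by
    have := intervalIntegrable_sub_sq h1' h2 (m - intervalAvg a b φ)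
    refine this.congr fun s _ => ?_
    ring
  refine ⟨(h1.sub intervalIntegrable_const).div_const _, ?_, fun p q hp hpq hq => ?_⟩
  · simp only [div_pow]
    exact h3.div_const _
  · refine ⟨(intervalAvg p q φ - m) / ε, ?_⟩
    have hv := (h.2 p q hp hpq hq).2
    rw [intervalAvg_eq hpq.le, inv_mul_le_iff₀ (sub_pos.2 hpq)] at hv
    simp only [sq_abs] at hv
    have : (fun s => ((φ s - m) / ε - (intervalAvg p q φ - m) / ε) ^ 2) =
        fun s => (φ s - intervalAvg p q φ) ^ 2 / ε ^ 2 := by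
      funext s
      rw [← div_pow]
      congr 1
      ring
    rw [this, intervalIntegral.integral_div, div_le_iff₀ (by positivity)]
    exact hv

theorem UnitOscillation.hasOscillationBound {a b ε : ℝ} (hab : a < b) {ψ : ℝ → ℝ}
    (h : UnitOscillation a b ψ) : HasOscillationBound a b (fun s => ε * ψ s) ε := by
  refine ⟨(intervalIntegrable_iff_integrableOn_Icc hab.le _).1 (h.int.const_mul ε),
    fun c d hc hcd hd => ?_⟩
  have g1 := intervalIntegrable_mono_Icc h.int hc hcd.le hd
  have g2 := intervalIntegrable_mono_Icc h.sq hc hcd.le hd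
  have havg : intervalAvg c d (fun s => ε * ψ s) = ε * intervalAvg c d ψ := by
    rw [intervalAvg_eq hcd.le, intervalAvg_eq hcd.le, intervalIntegral.integral_const_mul]
    ring
  have hfun : (fun s => |ε * ψ s - intervalAvg c d (fun s => ε * ψ s)| ^ 2) =
      fun s => ε ^ 2 * (ψ s - intervalAvg c d ψ) ^ 2 := by
    funext s
    rw [sq_abs, havg]
    ring
  rw [hfun]
  refine ⟨(intervalIntegrable_iff_integrableOn_Icc hcd.le _).1
    ((intervalIntegrable_sub_sq g1 g2 _).const_mul _), ?_⟩
  rw [intervalAvg_eq hcd.le, intervalIntegral.integral_const_mul,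
    inv_mul_le_iff₀ (sub_pos.2 hcd), mul_comm]
  exact mul_le_mul_of_nonneg_right
    (h.variance_le hc hcd hd (integral_eq_intervalAvg_mul hcd ψ)) (sq_nonneg ε)

/-- The tail as an integral of the normalized function. -/
theorem oscillationTail_eq {a b ε : ℝ} (hab : a < b) (hε : 0 < ε) {φ : ℝ → ℝ}
    (h : IntegrableOn φ (Set.Icc a b)) (t : ℝ) :
    oscillationTail a b t φ =
      (b - a)⁻¹ * ∫ s in a..b, levelIndicator (t / ε) |(φ s - intervalAvg a b φ) / ε| := by
  rw [oscillationTail, intervalIntegral.integral_of_le hab.le, ← integral_Icc_eq_integral_Ioc]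
  congr 1
  set S : Set ℝ := {s | t ≤ |φ s - intervalAvg a b φ|} with hS
  have hfun : (fun s => levelIndicator (t / ε) |(φ s - intervalAvg a b φ) / ε|) =
      S.indicator 1 := by
    funext s
    have hiff : t / ε ≤ |(φ s - intervalAvg a b φ) / ε| ↔ s ∈ S := by
      rw [abs_div, abs_of_pos hε, div_le_div_iff_of_pos_right hε]
      rfl
    by_cases hs : s ∈ S
    · rw [levelIndicator_of_le (hiff.2 hs), Set.indicator_of_mem hs, Pi.one_apply]
    · rw [levelIndicator_of_lt (not_le.1 fun h' => hs (hiff.1 h')), Set.indicator_of_notMem hs]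
  have hmeas : NullMeasurableSet S (volume.restrict (Set.Icc a b)) :=
    nullMeasurableSet_le aemeasurable_const (h.aemeasurable.sub_const _).abs
  have hset : {s ∈ Set.Icc a b | t ≤ |φ s - intervalAvg a b φ|} = S ∩ Set.Icc a b := by
    ext s
    exact and_comm
  rw [hfun, integral_indicator₀ hmeas, hset]
  simp only [Pi.one_apply, integral_const, smul_eq_mul, mul_one]
  rw [measureReal_restrict_apply MeasurableSet.univ, Set.univ_inter, measureReal_def,
    measureReal_def, Measure.restrict_apply₀ hmeas]

theorem integral_normalized_eq_zero {a b ε : ℝ} (hab : a < b) {φ : ℝ → ℝ}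
    (h : IntegrableOn φ (Set.Icc a b)) :
    ∫ s in a..b, (φ s - intervalAvg a b φ) / ε = 0 := by
  rw [intervalIntegral.integral_div, intervalIntegral.integral_sub
    ((intervalIntegrable_iff_integrableOn_Icc hab.le _).2 h) intervalIntegrable_const,
    intervalIntegral.integral_const, smul_eq_mul, integral_eq_intervalAvg_mul hab]
  ring

theorem oscillationTail_le_one {a b : ℝ} (hab : a < b) (t : ℝ) (φ : ℝ → ℝ) :
    oscillationTail a b t φ ≤ 1 := by
  rw [oscillationTail, inv_mul_le_iff₀ (sub_pos.2 hab), mul_one]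
  refine (measureReal_mono (Set.sep_subset _ _) measure_Icc_lt_top.ne).trans ?_
  rw [Real.volume_real_Icc_of_le hab.le]

theorem oscillationTail_le_sq {a b ε t : ℝ} (hab : a < b) (hε : 0 < ε) (ht : 0 < t)
    {φ : ℝ → ℝ} (hφ : φ ∈ BMOBall a b ε) : oscillationTail a b t φ ≤ ε ^ 2 / t ^ 2 := by
  have h := hasOscillationBound_of_mem_BMOBall hφ
  have hC := (h.unitOscillation hab hε (intervalAvg a b φ)).sq_mul_integral_levelIndicator_abs_le
    hab (integral_normalized_eq_zero hab h.1) (t := t / ε) (by positivity)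
  rw [oscillationTail_eq hab hε h.1, inv_mul_le_iff₀ (sub_pos.2 hab)]
  have h2 : ε ^ 2 / t ^ 2 = ((t / ε) ^ 2)⁻¹ := by rw [div_pow, inv_div]
  rw [h2, mul_comm (b - a), ← div_eq_inv_mul, le_div_iff₀ (by positivity), mul_comm]
  exact hC

theorem oscillationTail_le_exp {a b ε t : ℝ} (hab : a < b) (hε : 0 < ε) (ht : 2 * ε ≤ t)
    {φ : ℝ → ℝ} (hφ : φ ∈ BMOBall a b ε) :
    oscillationTail a b t φ ≤ Real.exp 1 ^ 2 / 4 * Real.exp (-(t / ε)) := by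
  have h := hasOscillationBound_of_mem_BMOBall hφ
  have ht' : 2 ≤ t / ε := by rwa [le_div_iff₀ hε]
  have hC := (h.unitOscillation hab hε (intervalAvg a b φ)).integral_levelIndicator_abs_le
    hab (integral_normalized_eq_zero hab h.1) (u := t / ε - 2) (by linarith)
  rw [sub_add_cancel] at hC
  rw [oscillationTail_eq hab hε h.1, inv_mul_le_iff₀ (sub_pos.2 hab), mul_comm (b - a)]
  refine hC.trans (le_of_eq ?_)
  rw [show -(t / ε - 2) = 1 + 1 + -(t / ε) by ring, Real.exp_add, Real.exp_add]
  ring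

/-! ### Building functions of bounded oscillation from monotone profiles -/

theorem intervalIntegral_congr_Ioc {f g : ℝ → ℝ} {p q : ℝ} (hpq : p ≤ q)
    (h : ∀ s ∈ Set.Ioc p q, f s = g s) : ∫ s in p..q, f s = ∫ s in p..q, g s := by
  rw [intervalIntegral.integral_of_le hpq, intervalIntegral.integral_of_le hpq]
  exact setIntegral_congr_fun measurableSet_Ioc h

theorem intervalIntegrable_sq_of_antitoneOn {f : ℝ → ℝ} {L : ℝ} (hL : 0 ≤ L)
    (hf : AntitoneOn f (Set.Icc 0 L)) (hf0 : 0 ≤ f L) :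
    IntervalIntegrable (fun s => f s ^ 2) volume 0 L := by
  apply AntitoneOn.intervalIntegrable
  rw [Set.uIcc_of_le hL]
  intro s hs t ht hst
  exact pow_le_pow_left₀ (hf0.trans (hf ht (Set.right_mem_Icc.2 hL) ht.2)) (hf hs ht hst) 2

/-- For a nonincreasing function, a second moment bound on `[0, q]` about a centre `w ≤ f q + 1`
passes to all intervals `[p, q]`. -/
theorem integral_sub_sq_le_of_antitoneOn {f : ℝ → ℝ} {p q w : ℝ} (hp : 0 ≤ p) (hpq : p ≤ q)
    (hf : AntitoneOn f (Set.Icc 0 q))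
    (hint : IntervalIntegrable (fun s => (f s - w) ^ 2) volume 0 q)
    (hw : w - 1 ≤ f q) (h : ∫ s in (0 : ℝ)..q, (f s - w) ^ 2 ≤ q) :
    ∫ s in p..q, (f s - w) ^ 2 ≤ q - p := by
  have hpI : p ∈ Set.Icc 0 q := ⟨hp, hpq⟩
  have hqI : q ∈ Set.Icc 0 q := ⟨hp.trans hpq, le_rfl⟩
  have i1 := intervalIntegrable_mono_Icc hint le_rfl hp hpq
  have i2 := intervalIntegrable_mono_Icc hint hp hpq le_rfl
  -- If `f p ≥ w + 1`, the discarded interval `[0, p]` carries at least its length in second moment,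
  -- which is subtracted. Otherwise `|f - w| ≤ 1` throughout `[p, q]`.
  rcases le_or_gt (w + 1) (f p) with hfp | hfp
  · rw [← intervalIntegral.integral_add_adjacent_intervals i1 i2] at h
    have : ∫ s in (0 : ℝ)..p, (1 : ℝ) ≤ ∫ s in (0 : ℝ)..p, (f s - w) ^ 2 := by
      refine intervalIntegral.integral_mono_on hp intervalIntegrable_const i1 fun s hs => ?_
      have := hf ⟨hs.1, hs.2.trans hpq⟩ hpI hs.2
      nlinarith
    rw [intervalIntegral.integral_const, smul_eq_mul] at this
    linarith
  · have : ∫ s in p..q, (f s - w) ^ 2 ≤ ∫ s in p..q, (1 : ℝ) := by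
      refine intervalIntegral.integral_mono_on hpq i2 intervalIntegrable_const fun s hs => ?_
      have hs' : s ∈ Set.Icc 0 q := ⟨hp.trans hs.1, hs.2⟩
      have h1 := hf hpI hs' hs.1
      have h2 := hf hs' hqI hs.2
      nlinarith
    rwa [intervalIntegral.integral_const, smul_eq_mul, mul_one] at this

theorem unitOscillation_of_antitoneOn {f : ℝ → ℝ} {L : ℝ} (hL : 0 ≤ L)
    (hf : AntitoneOn f (Set.Icc 0 L)) (hf0 : 0 ≤ f L)
    (h : ∀ q, 0 < q → q ≤ L → ∃ w, w - 1 ≤ f q ∧ ∫ s in (0 : ℝ)..q, (f s - w) ^ 2 ≤ q) :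
    UnitOscillation 0 L f := by
  have h1 : IntervalIntegrable f volume 0 L :=
    AntitoneOn.intervalIntegrable (by rwa [Set.uIcc_of_le hL])
  have h2 := intervalIntegrable_sq_of_antitoneOn hL hf hf0
  refine ⟨h1, h2, fun p q hp hpq hq => ?_⟩
  have hq0 : 0 < q := hp.trans_lt hpq
  obtain ⟨w, hw, hwq⟩ := h q hq0 hq
  exact ⟨w, integral_sub_sq_le_of_antitoneOn hp hpq.le (hf.mono (Set.Icc_subset_Icc_right hq))
    (intervalIntegrable_sub_sq (intervalIntegrable_mono_Icc h1 le_rfl hq0.le hq)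
      (intervalIntegrable_mono_Icc h2 le_rfl hq0.le hq) w) hw hwq⟩

/-- The extension of a function on `[0, 2]` to `[0, 4]` that is odd about `2`. -/
noncomputable def oddExtension (f : ℝ → ℝ) (s : ℝ) : ℝ := if s ≤ 2 then f s else -f (4 - s)

theorem integral_oddExtension_left (f : ℝ → ℝ) (G : ℝ → ℝ) {p q : ℝ} (hpq : p ≤ q) (hq : q ≤ 2) :
    ∫ s in p..q, G (oddExtension f s) = ∫ s in p..q, G (f s) :=
  intervalIntegral_congr_Ioc hpq fun s hs => by rw [oddExtension, if_pos (hs.2.trans hq)]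

theorem integral_oddExtension_right (f : ℝ → ℝ) (G : ℝ → ℝ) {p q : ℝ} (hp : 2 ≤ p) (hpq : p ≤ q) :
    ∫ s in p..q, G (oddExtension f s) = ∫ s in (4 - q)..(4 - p), G (-f s) := by
  rw [← intervalIntegral.integral_comp_sub_left (fun s => G (-f s))]
  exact intervalIntegral_congr_Ioc hpq fun s hs => by
    rw [oddExtension, if_neg (not_le.2 (hp.trans_lt hs.1))]

theorem intervalIntegrable_oddExtension (f : ℝ → ℝ) (G : ℝ → ℝ)
    (h1 : IntervalIntegrable (fun s => G (f s)) volume 0 2)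
    (h2 : IntervalIntegrable (fun s => G (-f s)) volume 0 2) :
    IntervalIntegrable (fun s => G (oddExtension f s)) volume 0 4 := by
  refine IntervalIntegrable.trans (b := 2) ?_ ?_
  · refine h1.congr fun s hs => ?_
    rw [Set.uIoc_of_le (by norm_num)] at hs
    simp only [oddExtension, if_pos hs.2]
  · have h3 := (h2.comp_sub_left 4).symm
    norm_num at h3
    refine h3.congr fun s hs => ?_
    rw [Set.uIoc_of_le (by norm_num)] at hs
    simp only [oddExtension, if_neg (not_le.2 hs.1)]

/-- Intervals on one side of `2` reduce to `f` or its reflection. An interval across `2` is tested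
with the centre `0`, for which its two halves contribute separately. -/
theorem unitOscillation_oddExtension {f : ℝ → ℝ} (H : UnitOscillation 0 2 f)
    (hsq : ∀ p, 0 ≤ p → p ≤ 2 → ∫ s in p..2, f s ^ 2 ≤ 2 - p) :
    UnitOscillation 0 4 (oddExtension f) := by
  have i2 := intervalIntegrable_oddExtension f (fun x => x ^ 2) H.sq (by simpa using H.sq)
  refine ⟨intervalIntegrable_oddExtension f id H.int H.int.neg, i2, fun p q hp hpq hq => ?_⟩
  rcases le_or_gt q 2 with hq2 | hq2
  · obtain ⟨w, hw⟩ := H.var p q hp hpq hq2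
    exact ⟨w, (integral_oddExtension_left f (fun x => (x - w) ^ 2) hpq.le hq2).trans_le hw⟩
  rcases le_or_gt 2 p with hp2 | hp2
  · obtain ⟨w, hw⟩ := H.neg.var (4 - q) (4 - p) (by linarith) (by linarith) (by linarith)
    refine ⟨w, (integral_oddExtension_right f (fun x => (x - w) ^ 2) hp2 hpq.le).trans_le ?_⟩
    linarith
  · refine ⟨0, ?_⟩
    simp only [sub_zero]
    rw [← intervalIntegral.integral_add_adjacent_intervals (b := 2)
      (intervalIntegrable_mono_Icc i2 hp hp2.le (by norm_num))
      (intervalIntegrable_mono_Icc i2 (by norm_num) hq2.le hq),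
      integral_oddExtension_left f (fun x => x ^ 2) hp2.le le_rfl,
      integral_oddExtension_right f (fun x => x ^ 2) le_rfl hq2.le]
    simp only [neg_sq]
    have h1 := hsq p hp hp2.le
    have h2 := hsq (4 - q) (by linarith) (by linarith)
    rw [show (4 - 2 : ℝ) = 2 by norm_num]
    linarith

theorem integral_oddExtension {f : ℝ → ℝ} (H : UnitOscillation 0 2 f) :
    ∫ s in (0 : ℝ)..4, oddExtension f s = 0 := by
  have i1 := intervalIntegrable_oddExtension f id H.int H.int.neg
  have e1 := integral_oddExtension_left f id (p := 0) (q := 2) (by norm_num) le_rfl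
  have e2 := integral_oddExtension_right f id (p := 2) (q := 4) le_rfl (by norm_num)
  simp only [id] at i1 e1 e2
  rw [← intervalIntegral.integral_add_adjacent_intervals (b := 2)
    (intervalIntegrable_mono_Icc i1 le_rfl (by norm_num) (by norm_num))
    (intervalIntegrable_mono_Icc i1 (by norm_num) (by norm_num) le_rfl), e1, e2]
  norm_num

theorem integral_levelIndicator_oddExtension {f : ℝ → ℝ} (H : UnitOscillation 0 2 f) (l : ℝ) :
    ∫ s in (0 : ℝ)..4, levelIndicator l |oddExtension f s| =
      2 * ∫ s in (0 : ℝ)..2, levelIndicator l |f s| := by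
  have i0 := intervalIntegrable_levelIndicator H.int.abs l
  have i1 := intervalIntegrable_oddExtension f (fun x => levelIndicator l |x|) i0
    (by simpa using i0)
  have e1 := integral_oddExtension_left f (fun x => levelIndicator l |x|) (p := 0) (q := 2)
    (by norm_num) le_rfl
  have e2 := integral_oddExtension_right f (fun x => levelIndicator l |x|) (p := 2) (q := 4)
    le_rfl (by norm_num)
  rw [← intervalIntegral.integral_add_adjacent_intervals (b := 2)
    (intervalIntegrable_mono_Icc i1 le_rfl (by norm_num) (by norm_num))
    (intervalIntegrable_mono_Icc i1 (by norm_num) (by norm_num) le_rfl), e1, e2]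
  norm_num
  ring

theorem UnitOscillation.comp_mul_add {L a b : ℝ} {ψ : ℝ → ℝ} (hL : 0 < L) (hab : a < b)
    (H : UnitOscillation 0 L ψ) :
    UnitOscillation a b (fun s => ψ (L / (b - a) * s + -(L / (b - a) * a))) := by
  set r := L / (b - a) with hr
  have hba : 0 < b - a := sub_pos.2 hab
  have hr0 : 0 < r := by positivity
  have hrb : r * b + -(r * a) = L := by
    rw [hr]; field_simp; ring
  have hint : ∀ g : ℝ → ℝ, IntervalIntegrable g volume 0 L →
      IntervalIntegrable (fun s => g (r * s + -(r * a))) volume a b := by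
    intro g hg
    have h1 := (hg.comp_add_right (-(r * a))).comp_mul_left (c := r)
    have e1 : (0 - -(r * a)) / r = a := by field_simp; ring
    have e2 : (L - -(r * a)) / r = b := by rw [← hrb]; field_simp; ring
    rwa [e1, e2] at h1
  refine ⟨hint ψ H.int, hint _ H.sq, fun p q hp hpq hq => ?_⟩
  obtain ⟨w, hw⟩ := H.var (r * p + -(r * a)) (r * q + -(r * a)) (by nlinarith) (by nlinarith)
    (by rw [← hrb]; nlinarith)
  refine ⟨w, ?_⟩
  rw [intervalIntegral.integral_comp_mul_add (fun x => (ψ x - w) ^ 2) hr0.ne', smul_eq_mul,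
    inv_mul_le_iff₀ hr0]
  linarith

theorem integral_comp_mul_add_Icc {L a b : ℝ} (hL : 0 < L) (hab : a < b) (g : ℝ → ℝ) :
    ∫ s in a..b, g (L / (b - a) * s + -(L / (b - a) * a)) =
      (b - a) / L * ∫ s in (0 : ℝ)..L, g s := by
  have hba : 0 < b - a := sub_pos.2 hab
  rw [intervalIntegral.integral_comp_mul_add g (by positivity), smul_eq_mul, inv_div]
  congr 2
  · ring
  · field_simp; ring

/-- Every admissible nonincreasing profile on `[0, 2]` gives a function in `BMO_ε([a, b])` with the
corresponding tail. -/
theorem exists_mem_BMOBall_oscillationTail_eq {a b ε : ℝ} (hab : a < b) (hε : 0 < ε) {f : ℝ → ℝ}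
    (hf : AntitoneOn f (Set.Icc 0 2)) (hf0 : 0 ≤ f 2) (hsq : ∫ s in (0 : ℝ)..2, f s ^ 2 ≤ 2)
    (h : ∀ q, 0 < q → q ≤ 2 → ∃ w, w - 1 ≤ f q ∧ ∫ s in (0 : ℝ)..q, (f s - w) ^ 2 ≤ q) (t : ℝ) :
    ∃ φ ∈ BMOBall a b ε,
      oscillationTail a b t φ = 1 / 2 * ∫ s in (0 : ℝ)..2, levelIndicator (t / ε) (f s) := by
  have H := unitOscillation_of_antitoneOn (by norm_num) hf hf0 h
  have hsq' : ∀ p, 0 ≤ p → p ≤ 2 → ∫ s in p..2, f s ^ 2 ≤ 2 - p := by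
    intro p hp hp2
    simpa using integral_sub_sq_le_of_antitoneOn (w := 0) hp hp2 hf (by simpa using H.sq)
      (by linarith) (by simpa using hsq)
  have HO := (unitOscillation_oddExtension H hsq').comp_mul_add (by norm_num) hab
  have HB := HO.hasOscillationBound (ε := ε) hab
  refine ⟨_, HB.mem_BMOBall hε.le, ?_⟩
  have hmean : intervalAvg a b
      (fun s => ε * oddExtension f (4 / (b - a) * s + -(4 / (b - a) * a))) = 0 := by
    rw [intervalAvg_eq hab.le, intervalIntegral.integral_const_mul,
      integral_comp_mul_add_Icc (by norm_num) hab, integral_oddExtension H]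
    ring
  rw [oscillationTail_eq hab hε HB.1, hmean]
  simp only [sub_zero, mul_div_cancel_left₀ _ hε.ne']
  rw [integral_comp_mul_add_Icc (by norm_num) hab
      (fun x => levelIndicator (t / ε) |oddExtension f x|),
    integral_levelIndicator_oddExtension H]
  have habs : ∫ s in (0 : ℝ)..2, levelIndicator (t / ε) |f s| =
      ∫ s in (0 : ℝ)..2, levelIndicator (t / ε) (f s) :=
    intervalIntegral_congr_Ioc (by norm_num) fun s hs => by
      rw [abs_of_nonneg (hf0.trans (hf ⟨hs.1.le, hs.2⟩ ⟨by norm_num, le_rfl⟩ hs.2))]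
  rw [habs]
  have hba : b - a ≠ 0 := (sub_pos.2 hab).ne'
  field_simp
  norm_num

/-! ### The extremal profiles -/

/-- The two-valued profile, extremal for Chebyshev's inequality. -/
noncomputable def stepProfile (t s : ℝ) : ℝ := if s ≤ 2 / t ^ 2 then t else 0

theorem integral_indicator_step {x : ℝ} (hx : 0 ≤ x) (hx2 : x ≤ 2) (c : ℝ) :
    ∫ s in (0 : ℝ)..2, (if s ≤ x then c else 0) = c * x := by
  have hint : ∀ p q : ℝ, IntervalIntegrable (fun s : ℝ => if s ≤ x then c else 0) volume p q := by
    intro p q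
    have : (fun s : ℝ => if s ≤ x then c else 0) = Set.indicator (Set.Iic x) fun _ => c := by
      funext s
      simp [Set.indicator_apply]
    rw [this]
    exact ⟨(integrableOn_const measure_Ioc_lt_top.ne).indicator measurableSet_Iic,
      (integrableOn_const measure_Ioc_lt_top.ne).indicator measurableSet_Iic⟩
  rw [← intervalIntegral.integral_add_adjacent_intervals (hint 0 x) (hint x 2),
    intervalIntegral_congr_Ioc (g := fun _ => c) hx fun s hs => if_pos hs.2,
    intervalIntegral_congr_Ioc (g := fun _ => 0) hx2 fun s hs => if_neg (not_le.2 hs.1)]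
  simp [mul_comm]

theorem exists_oscillationTail_eq_of_step {a b ε : ℝ} (hab : a < b) (hε : 0 < ε) {r t : ℝ}
    (hr1 : 1 ≤ r) (hr2 : r ≤ 2) (ht0 : r = 1 ∨ 0 < t / ε) (ht : t / ε ≤ r) :
    ∃ φ ∈ BMOBall a b ε, oscillationTail a b t φ = 1 / r ^ 2 := by
  have hr0 : 0 < r := by linarith
  have hx0 : 0 < 2 / r ^ 2 := by positivity
  have hx2 : 2 / r ^ 2 ≤ 2 := div_le_self (by norm_num) (one_le_pow₀ hr1)
  have hanti : AntitoneOn (stepProfile r) (Set.Icc 0 2) := by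
    intro s _ s' _ hss
    unfold stepProfile
    split_ifs <;> linarith
  have hnn : ∀ s, 0 ≤ stepProfile r s := by
    intro s
    unfold stepProfile
    split_ifs <;> linarith
  have hsq : ∫ s in (0 : ℝ)..2, stepProfile r s ^ 2 ≤ 2 := by
    have : (fun s => stepProfile r s ^ 2) = fun s => if s ≤ 2 / r ^ 2 then r ^ 2 else 0 := by
      funext s
      unfold stepProfile
      split_ifs <;> simp
    rw [this, integral_indicator_step hx0.le hx2, mul_div_cancel₀]
    positivity
  have h1 : IntervalIntegrable (stepProfile r) volume 0 2 :=
    AntitoneOn.intervalIntegrable (by rwa [Set.uIcc_of_le (by norm_num)])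
  have h2 := intervalIntegrable_sq_of_antitoneOn (by norm_num) hanti (hnn 2)
  have hcond : ∀ q, 0 < q → q ≤ 2 → ∃ w, w - 1 ≤ stepProfile r q ∧
      ∫ s in (0 : ℝ)..q, (stepProfile r s - w) ^ 2 ≤ q := by
    intro q hq hq2
    -- The values `0` and `r` both lie at distance `r / 2 ≤ 1` from this centre.
    refine ⟨r / 2, by linarith [hnn q], ?_⟩
    have : ∫ s in (0 : ℝ)..q, (stepProfile r s - r / 2) ^ 2 ≤ ∫ s in (0 : ℝ)..q, (1 : ℝ) := by
      refine intervalIntegral.integral_mono_on hq.le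
        (intervalIntegrable_mono_Icc (intervalIntegrable_sub_sq h1 h2 _) le_rfl hq.le hq2)
        intervalIntegrable_const fun s _ => ?_
      unfold stepProfile
      split_ifs <;> nlinarith
    simpa using this
  obtain ⟨φ, hφ, htail⟩ := exists_mem_BMOBall_oscillationTail_eq hab hε hanti (hnn 2) hsq hcond t
  refine ⟨φ, hφ, ?_⟩
  have hlev : ∫ s in (0 : ℝ)..2, levelIndicator (t / ε) (stepProfile r s) =
      ∫ s in (0 : ℝ)..2, (if s ≤ 2 / r ^ 2 then 1 else 0) := by
    refine intervalIntegral_congr_Ioc (by norm_num) fun s hs => ?_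
    unfold stepProfile
    split_ifs with h
    · exact levelIndicator_of_le ht
    -- For `r = 1` the step fills `[0, 2]`, so this branch is empty and the level may be
    -- nonpositive.
    · rcases ht0 with rfl | ht0
      · norm_num at h
        exact absurd hs.2 (not_le.2 h)
      · exact levelIndicator_of_lt ht0
  rw [htail, hlev, integral_indicator_step hx0.le hx2]
  ring

/-- The logarithmic profile with a final jump of height `2`. -/
noncomputable def logProfile (u s : ℝ) : ℝ :=
  if s ≤ Real.exp (-u) / 2 then u + 2 else if s ≤ Real.exp (-u) then u else
    if s ≤ 1 then -Real.log s else 0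

theorem logProfile_antitoneOn {u : ℝ} (hu : 0 ≤ u) :
    AntitoneOn (logProfile u) (Set.Icc 0 2) := by
  intro s _ s' _ hss
  have hx := Real.exp_pos (-u)
  have hlog : ∀ y, ¬ y ≤ Real.exp (-u) → -Real.log y ≤ u := by
    intro y hy
    have := Real.log_le_log hx (not_le.1 hy).le
    rw [Real.log_exp] at this
    linarith
  have hlog0 : ∀ y, ¬ y ≤ Real.exp (-u) → y ≤ 1 → 0 ≤ -Real.log y := by
    intro y hy hy1
    linarith [Real.log_nonpos (hx.trans (not_le.1 hy)).le hy1]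
  unfold logProfile
  split_ifs with h1 h2 h3 h4 h5 h6 h7 h8 h9 h10 h11 h12 <;>
    first
    | linarith
    | linarith [hlog s' (by assumption)]
    | linarith [hlog s (by assumption)]
    | linarith [hlog0 s (by assumption) (by assumption)]
    | linarith [Real.log_le_log (hx.trans (not_le.1 (by assumption : ¬ s ≤ Real.exp (-u)))) hss]

theorem integral_log_sq {x q : ℝ} (hx : 0 < x) (hxq : x ≤ q) :
    ∫ s in x..q, Real.log s ^ 2 =
      q * (Real.log q ^ 2 - 2 * Real.log q + 2) - x * (Real.log x ^ 2 - 2 * Real.log x + 2) := by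
  have hpos : ∀ s ∈ Set.uIcc x q, s ≠ 0 := by
    intro s hs
    rw [Set.uIcc_of_le hxq] at hs
    exact (hx.trans_le hs.1).ne'
  refine intervalIntegral.integral_eq_sub_of_hasDerivAt
    (f := fun s => s * (Real.log s ^ 2 - 2 * Real.log s + 2)) (fun s hs => ?_) ?_
  · have hl := Real.hasDerivAt_log (hpos s hs)
    refine ((hasDerivAt_id s).mul (((hl.pow 2).sub (hl.const_mul 2)).add_const 2)).congr_deriv ?_
    have := hpos s hs
    simp
    field_simp
    ring
  · exact ((Real.continuousOn_log.mono fun s hs => hpos s hs).pow 2).intervalIntegrable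

theorem integral_logProfile_comp {u : ℝ} (G : ℝ → ℝ)
    (hG : IntervalIntegrable (fun s => G (logProfile u s)) volume 0 2) {q : ℝ}
    (hq : Real.exp (-u) ≤ q) (hq1 : q ≤ 1) :
    ∫ s in (0 : ℝ)..q, G (logProfile u s) =
      Real.exp (-u) / 2 * G (u + 2) + Real.exp (-u) / 2 * G u +
        ∫ s in Real.exp (-u)..q, G (-Real.log s) := by
  have hx := Real.exp_pos (-u)
  rw [← intervalIntegral.integral_add_adjacent_intervals (b := Real.exp (-u))
      (intervalIntegrable_mono_Icc hG le_rfl hx.le (by linarith))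
      (intervalIntegrable_mono_Icc hG hx.le hq (by linarith)),
    ← intervalIntegral.integral_add_adjacent_intervals (b := Real.exp (-u) / 2)
      (intervalIntegrable_mono_Icc hG le_rfl (by linarith) (by linarith))
      (intervalIntegrable_mono_Icc hG (by linarith) (by linarith) (by linarith)),
    intervalIntegral_congr_Ioc (g := fun _ => G (u + 2)) (by linarith) fun s hs => by
      rw [logProfile, if_pos hs.2],
    intervalIntegral_congr_Ioc (p := Real.exp (-u) / 2) (g := fun _ => G u) (by linarith)
      fun s hs => by rw [logProfile, if_neg (not_le.2 hs.1), if_pos hs.2],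
    intervalIntegral_congr_Ioc (p := Real.exp (-u)) (g := fun s => G (-Real.log s)) hq
      fun s hs => by
        rw [logProfile, if_neg (not_le.2 (by linarith [hs.1])), if_neg (not_le.2 hs.1),
          if_pos (hs.2.trans hq1)]]
  simp only [intervalIntegral.integral_const, smul_eq_mul]
  ring

theorem exists_oscillationTail_eq_of_log {a b ε : ℝ} (hab : a < b) (hε : 0 < ε) {t : ℝ}
    (ht : 2 * ε ≤ t) :
    ∃ φ ∈ BMOBall a b ε,
      oscillationTail a b t φ = Real.exp 1 ^ 2 / 4 * Real.exp (-(t / ε)) := by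
  obtain ⟨u, hu, hut⟩ : ∃ u, 0 ≤ u ∧ t / ε = u + 2 :=
    ⟨t / ε - 2, by rw [sub_nonneg, le_div_iff₀ hε]; exact ht, by ring⟩
  have hx := Real.exp_pos (-u)
  have hx1 : Real.exp (-u) ≤ 1 := Real.exp_le_one_iff.2 (by linarith)
  have hanti := logProfile_antitoneOn hu
  have hf2 : logProfile u 2 = 0 := by
    rw [logProfile, if_neg (by linarith), if_neg (by linarith), if_neg (by norm_num)]
  have h1 : IntervalIntegrable (logProfile u) volume 0 2 :=
    AntitoneOn.intervalIntegrable (by rwa [Set.uIcc_of_le (by norm_num)])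
  have h2 := intervalIntegrable_sq_of_antitoneOn (by norm_num) hanti hf2.ge
  -- On `[0, e^{-u}]` the function `-log` has mean `u + 1` and variance 1, as do the values `u + 2`
  -- and `u` on equal halves. Hence the first two moments on `[0, q]` are those of `-log`.
  have hM1 : ∀ q, Real.exp (-u) ≤ q → q ≤ 1 →
      ∫ s in (0 : ℝ)..q, logProfile u s = q * (1 - Real.log q) := by
    intro q hq hq1
    have := integral_logProfile_comp id h1 hq hq1
    simp only [id] at this
    rw [this, intervalIntegral.integral_neg, integral_log, Real.log_exp]
    ring
  have hM2 : ∀ q, Real.exp (-u) ≤ q → q ≤ 1 →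
      ∫ s in (0 : ℝ)..q, logProfile u s ^ 2 =
        q * (Real.log q ^ 2 - 2 * Real.log q + 2) := by
    intro q hq hq1
    have := integral_logProfile_comp (fun x => x ^ 2) h2 hq hq1
    simp only [neg_sq] at this
    rw [this, integral_log_sq hx hq, Real.log_exp]
    ring
  have hbeyond : ∀ q, 1 ≤ q → q ≤ 2 → ∀ G : ℝ → ℝ, G 0 = 0 →
      IntervalIntegrable (fun s => G (logProfile u s)) volume 0 2 →
      ∫ s in (0 : ℝ)..q, G (logProfile u s) = ∫ s in (0 : ℝ)..1, G (logProfile u s) := by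
    intro q hq hq2 G hG0 hG
    rw [← intervalIntegral.integral_add_adjacent_intervals (b := 1)
      (intervalIntegrable_mono_Icc hG le_rfl (by norm_num) (by norm_num))
      (intervalIntegrable_mono_Icc hG (by norm_num) hq hq2),
      intervalIntegral_congr_Ioc (p := 1) (g := fun _ => (0 : ℝ)) hq fun s hs => by
        have := hs.1
        rw [logProfile, if_neg (by linarith), if_neg (by linarith), if_neg (by linarith), hG0]]
    simp
  have hsq : ∫ s in (0 : ℝ)..2, logProfile u s ^ 2 ≤ 2 := by
    rw [hbeyond 2 (by norm_num) le_rfl (fun x => x ^ 2) (by norm_num) h2, hM2 1 hx1 le_rfl,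
      Real.log_one]
    norm_num
  have hcond : ∀ q, 0 < q → q ≤ 2 → ∃ w, w - 1 ≤ logProfile u q ∧
      ∫ s in (0 : ℝ)..q, (logProfile u s - w) ^ 2 ≤ q := by
    intro q hq hq2
    have g1 := intervalIntegrable_mono_Icc h1 le_rfl hq.le hq2
    have g2 := intervalIntegrable_mono_Icc h2 le_rfl hq.le hq2
    rcases le_or_gt q (Real.exp (-u)) with hqx | hqx
    -- Only the values `u + 2` and `u` occur, both at distance 1 from `u + 1`.
    · refine ⟨u + 1, ?_, ?_⟩
      · unfold logProfile
        split_ifs <;> linarith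
      · have : ∫ s in (0 : ℝ)..q, (logProfile u s - (u + 1)) ^ 2 = ∫ s in (0 : ℝ)..q, (1 : ℝ) := by
          refine intervalIntegral_congr_Ioc hq.le fun s hs => ?_
          unfold logProfile
          rw [if_pos (hs.2.trans hqx)]
          split_ifs <;> ring
        rw [this]
        simp
    rcases le_or_gt q 1 with hq1 | hq1
    -- This is the mean on `[0, q]`; it equals `f q + 1`, and the variance is exactly 1.
    · refine ⟨1 - Real.log q, ?_, ?_⟩
      · rw [logProfile, if_neg (by linarith), if_neg (by linarith), if_pos hq1]
        linarith
      · rw [integral_sub_sq g1 g2, hM1 q hqx.le hq1, hM2 q hqx.le hq1]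
        apply le_of_eq
        ring
    -- Again the mean on `[0, q]`, since the profile has integral 1 and vanishes beyond 1. The
    -- second moment about it is `2 - 1/q ≤ q`.
    · refine ⟨1 / q, ?_, ?_⟩
      · rw [logProfile, if_neg (by linarith), if_neg (by linarith), if_neg (by linarith)]
        rw [sub_nonpos, div_le_one hq]
        exact hq1.le
      · rw [integral_sub_sq g1 g2, hbeyond q hq1.le hq2 (fun x => x ^ 2) (by norm_num) h2,
          hbeyond q hq1.le hq2 (fun x => x) rfl h1, hM1 1 hx1 le_rfl, hM2 1 hx1 le_rfl,
          Real.log_one]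
        have : 2 - 1 / q ≤ q := by
          rw [sub_le_iff_le_add, ← sub_nonneg]
          have : q + 1 / q - 2 = (q - 1) ^ 2 / q := by field_simp; ring
          rw [this]
          positivity
        refine le_trans (le_of_eq ?_) this
        field_simp
        ring
  obtain ⟨φ, hφ, htail⟩ := exists_mem_BMOBall_oscillationTail_eq hab hε hanti hf2.ge hsq hcond t
  refine ⟨φ, hφ, ?_⟩
  have hlev : ∫ s in (0 : ℝ)..2, levelIndicator (t / ε) (logProfile u s) =
      ∫ s in (0 : ℝ)..2, (if s ≤ Real.exp (-u) / 2 then 1 else 0) := by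
    refine intervalIntegral_congr_Ioc (by norm_num) fun s hs => ?_
    rw [hut]
    by_cases h : s ≤ Real.exp (-u) / 2
    · rw [if_pos h, logProfile, if_pos h, levelIndicator_of_le le_rfl]
    · rw [if_neg h]
      apply levelIndicator_of_lt
      rw [logProfile, if_neg h]
      split_ifs with h3 h4
      · linarith
      · have := Real.log_le_log hx (not_le.1 h3).le
        rw [Real.log_exp] at this
        linarith
      · linarith
  rw [htail, hlev, integral_indicator_step (by linarith) (by linarith), hut,
    show -(u + 2) = -u + -1 + -1 by ring, Real.exp_add, Real.exp_add, Real.exp_neg 1]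
  have := (Real.exp_pos 1).ne'
  field_simp
  ring

/-! ### Sharp tail bounds and the constants of the weak inequality -/

theorem isGreatest_oscillationTail_of_le {a b ε t : ℝ} (hab : a < b) (hε : 0 < ε) (ht : t ≤ ε) :
    IsGreatest (oscillationTail a b t '' BMOBall a b ε) 1 := by
  constructor
  · obtain ⟨φ, hφ, h⟩ := exists_oscillationTail_eq_of_step hab hε (r := 1) (t := t) le_rfl
      (by norm_num) (Or.inl rfl) (by rwa [div_le_one hε])
    exact ⟨φ, hφ, by rw [h]; norm_num⟩
  · rintro _ ⟨φ, -, rfl⟩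
    exact oscillationTail_le_one hab t φ

theorem isGreatest_oscillationTail_of_le_two_mul {a b ε t : ℝ} (hab : a < b) (hε : 0 < ε)
    (ht1 : ε ≤ t) (ht2 : t ≤ 2 * ε) :
    IsGreatest (oscillationTail a b t '' BMOBall a b ε) (ε ^ 2 / t ^ 2) := by
  have ht0 : 0 < t := hε.trans_le ht1
  constructor
  · obtain ⟨φ, hφ, h⟩ := exists_oscillationTail_eq_of_step hab hε (r := t / ε) (t := t)
      (by rwa [one_le_div hε]) (by rwa [div_le_iff₀ hε]) (Or.inr (by positivity)) le_rfl
    exact ⟨φ, hφ, by rw [h, div_pow, one_div_div]⟩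
  · rintro _ ⟨φ, hφ, rfl⟩
    exact oscillationTail_le_sq hab hε ht0 hφ

theorem isGreatest_oscillationTail_of_two_mul_le {a b ε t : ℝ} (hab : a < b) (hε : 0 < ε)
    (ht : 2 * ε ≤ t) :
    IsGreatest (oscillationTail a b t '' BMOBall a b ε)
      (Real.exp 1 ^ 2 / 4 * Real.exp (-(t / ε))) := by
  constructor
  · exact exists_oscillationTail_eq_of_log hab hε ht
  · rintro _ ⟨φ, hφ, rfl⟩
    exact oscillationTail_le_exp hab hε ht hφ

theorem weakJohnNirenbergLarge_exp {a b : ℝ} (hab : a < b) :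
    WeakJohnNirenbergLarge a b (Real.exp 1 ^ 2 / 4) 1 := by
  intro φ hφ hn t ht
  rw [one_mul]
  exact oscillationTail_le_exp hab hn ht ⟨hφ, le_rfl⟩

theorem weakJohnNirenberg_exp {a b : ℝ} (hab : a < b) :
    WeakJohnNirenberg a b (Real.exp 1) 1 := by
  intro φ hφ hn t
  have hball : φ ∈ BMOBall a b (bmoNorm a b φ) := ⟨hφ, le_rfl⟩
  set N := bmoNorm a b φ with hN
  rw [one_mul, ← Real.exp_add]
  rcases le_total t N with h1 | h1
  · refine (oscillationTail_le_one hab t φ).trans (Real.one_le_exp ?_)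
    have : t / N ≤ 1 := (div_le_one hn).2 h1
    linarith
  have ht0 : 0 < t := hn.trans_le h1
  rcases le_total t (2 * N) with h2 | h2
  · refine (oscillationTail_le_sq hab hn ht0 hball).trans ?_
    have hx0 : 0 < t / N := by positivity
    have hx2 : t / N ≤ 2 := by rwa [div_le_iff₀ hn]
    have hx1 : 1 ≤ t / N := by rwa [one_le_div hn]
    have hsq : N ^ 2 / t ^ 2 = Real.exp (-(2 * Real.log (t / N))) := by
      rw [Real.exp_neg, two_mul, Real.exp_add, Real.exp_log hx0]
      field_simp
    rw [hsq]
    apply Real.exp_le_exp.2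
    have hlog := Real.one_sub_inv_le_log_of_pos hx0
    -- For `x = t / N` in `[1, 2]` the claim is `x⁻² ≤ e^{1 - x}`, that is `x - 1 ≤ 2 log x`. It
    -- follows from `log x ≥ 1 - 1/x`, because the difference is `(x - 1)(2 - x) / x`.
    have : t / N - 1 ≤ 2 * (1 - (t / N)⁻¹) := by
      rw [← sub_nonneg]
      have : 2 * (1 - (t / N)⁻¹) - (t / N - 1) = (t / N - 1) * (2 - t / N) * (t / N)⁻¹ := by
        generalize t / N = x at hx0
        field_simp
      rw [this]
      exact mul_nonneg (mul_nonneg (by linarith) (by linarith)) (by positivity)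
    linarith
  · refine (oscillationTail_le_exp hab hn h2 hball).trans ?_
    rw [Real.exp_add]
    refine mul_le_mul_of_nonneg_right ?_ (Real.exp_pos _).le
    nlinarith [Real.exp_one_lt_d9, Real.exp_pos 1]

/-- Extremal functions for the exponential bound have the largest possible norm. -/
theorem bmoNorm_eq_one_of_tail_exp {a b t : ℝ} (hab : a < b) (ht : 2 ≤ t) {φ : ℝ → ℝ}
    (hφ : φ ∈ BMOBall a b 1)
    (h : oscillationTail a b t φ = Real.exp 1 ^ 2 / 4 * Real.exp (-(t / 1))) :
    bmoNorm a b φ = 1 := by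
  refine le_antisymm hφ.2 (not_lt.1 fun hlt => ?_)
  -- The tail bound needs a positive radius, while the norm itself could be zero; so a `δ` strictly
  -- between is used.
  obtain ⟨δ, hδ, hδ1⟩ := exists_between (max_lt hlt zero_lt_one)
  have hδ0 : 0 < δ := (le_max_right _ _).trans_lt hδ
  have hb := oscillationTail_le_exp hab hδ0 (by linarith) (t := t)
    (φ := φ) ⟨hφ.1, ((le_max_left _ _).trans_lt hδ).le⟩
  rw [h] at hb
  have h1 := Real.exp_le_exp.1 (le_of_mul_le_mul_left hb (by positivity))
  have h2 : t / 1 < t / δ := div_lt_div_of_pos_left (by linarith) hδ0 hδ1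
  linarith

theorem bmoNorm_eq_one_of_tail_one {a b : ℝ} (hab : a < b) {φ : ℝ → ℝ}
    (hφ : φ ∈ BMOBall a b 1) (h : oscillationTail a b 1 φ = 1) : bmoNorm a b φ = 1 := by
  refine le_antisymm hφ.2 (not_lt.1 fun hlt => ?_)
  obtain ⟨δ, hδ, hδ1⟩ := exists_between (max_lt hlt zero_lt_one)
  have hδ0 : 0 < δ := (le_max_right _ _).trans_lt hδ
  have hb := oscillationTail_le_sq hab hδ0 zero_lt_one
    (φ := φ) ⟨hφ.1, ((le_max_left _ _).trans_lt hδ).le⟩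
  rw [h] at hb
  nlinarith

/-- The logarithmic extremal at level `t` has norm exactly 1, so its tail tests the inequality
directly. At `t = 2` and `c₂ = 1` this gives the least `c₁`; as `t → ∞` it excludes `c₂ > 1`. -/
theorem exp_le_of_weakJohnNirenbergLarge {a b c₁ c₂ t : ℝ} (hab : a < b) (ht : 2 ≤ t)
    (h : WeakJohnNirenbergLarge a b c₁ c₂) :
    Real.exp 1 ^ 2 / 4 * Real.exp ((c₂ - 1) * t) ≤ c₁ := by
  obtain ⟨φ, hφ, htail⟩ :=
    exists_oscillationTail_eq_of_log hab zero_lt_one (t := t) (by linarith)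
  have hn := bmoNorm_eq_one_of_tail_exp hab ht hφ htail
  have := h φ hφ.1 (by rw [hn]; exact zero_lt_one) t (by rw [hn]; linarith)
  rw [htail, hn, div_one, div_one] at this
  have h2 := mul_le_mul_of_nonneg_right this (Real.exp_pos (c₂ * t)).le
  rw [mul_assoc, mul_assoc, ← Real.exp_add, ← Real.exp_add, neg_add_cancel, Real.exp_zero,
    mul_one] at h2
  rwa [show (c₂ - 1) * t = -t + c₂ * t by ring]

theorem le_one_of_weakJohnNirenbergLarge {a b c₁ c₂ : ℝ} (hab : a < b)
    (h : WeakJohnNirenbergLarge a b c₁ c₂) : c₂ ≤ 1 := by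
  by_contra! hc
  have hc' : 0 < c₂ - 1 := sub_pos.2 hc
  set K := Real.exp 1 ^ 2 / 4 with hK
  have hK0 : 0 < K := by positivity
  -- Chosen so that `K (1 + (c₂ - 1) t) ≥ K + c₁ > c₁`, against `exp y ≥ 1 + y`.
  set t := max 2 (c₁ / K / (c₂ - 1)) with ht
  have h1 := exp_le_of_weakJohnNirenbergLarge hab (le_max_left 2 (c₁ / K / (c₂ - 1))) h
  rw [← ht, ← hK] at h1
  have h2 : c₁ / K ≤ (c₂ - 1) * t := by
    rw [← div_le_iff₀' hc']
    exact le_max_right _ _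
  have h3 := Real.add_one_le_exp ((c₂ - 1) * t)
  rw [div_le_iff₀ hK0] at h2
  nlinarith

theorem WeakJohnNirenberg.large {a b c₁ c₂ : ℝ} (h : WeakJohnNirenberg a b c₁ c₂) :
    WeakJohnNirenbergLarge a b c₁ c₂ :=
  fun φ hφ hn t _ => h φ hφ hn t

theorem mainTheorem2 (a b : ℝ) (hab : a < b) :
    (∀ ε t : ℝ, 0 < ε →
      (t ≤ ε → IsGreatest (oscillationTail a b t '' BMOBall a b ε) 1) ∧
      (ε ≤ t → t ≤ 2 * ε →
        IsGreatest (oscillationTail a b t '' BMOBall a b ε) (ε ^ 2 / t ^ 2)) ∧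
      (2 * ε ≤ t →
        IsGreatest (oscillationTail a b t '' BMOBall a b ε)
          (Real.exp 1 ^ 2 / 4 * Real.exp (-(t / ε))))) ∧
    IsGreatest {c₂ : ℝ | ∃ c₁ : ℝ, WeakJohnNirenberg a b c₁ c₂} 1 ∧
    IsGreatest {c₂ : ℝ | ∃ c₁ : ℝ, WeakJohnNirenbergLarge a b c₁ c₂} 1 ∧
    IsLeast {c₁ : ℝ | WeakJohnNirenbergLarge a b c₁ 1} (Real.exp 1 ^ 2 / 4) ∧
    IsLeast {c₁ : ℝ | WeakJohnNirenberg a b c₁ 1} (Real.exp 1) := by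
  refine ⟨fun ε t hε => ⟨isGreatest_oscillationTail_of_le hab hε,
    isGreatest_oscillationTail_of_le_two_mul hab hε,
    isGreatest_oscillationTail_of_two_mul_le hab hε⟩, ?_, ?_, ?_, ?_⟩
  · refine ⟨⟨_, weakJohnNirenberg_exp hab⟩, ?_⟩
    rintro c₂ ⟨c₁, h⟩
    exact le_one_of_weakJohnNirenbergLarge hab h.large
  · refine ⟨⟨_, weakJohnNirenbergLarge_exp hab⟩, ?_⟩
    rintro c₂ ⟨c₁, h⟩
    exact le_one_of_weakJohnNirenbergLarge hab h
  · refine ⟨weakJohnNirenbergLarge_exp hab, fun c₁ h => ?_⟩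
    simpa using exp_le_of_weakJohnNirenbergLarge hab le_rfl h
  · refine ⟨weakJohnNirenberg_exp hab, fun c₁ h => ?_⟩
    -- At the level equal to the norm the tail can still be 1, so `1 ≤ c₁ e^{-1}`.
    obtain ⟨φ, hφ, htail⟩ := exists_oscillationTail_eq_of_step hab zero_lt_one (r := 1) (t := 1)
      le_rfl (by norm_num) (Or.inl rfl) (by norm_num)
    rw [one_pow, div_one] at htail
    have hn := bmoNorm_eq_one_of_tail_one hab hφ htail
    have := h φ hφ.1 (by rw [hn]; exact zero_lt_one) 1
    rw [htail, hn, one_mul, div_one, Real.exp_neg, ← div_eq_mul_inv,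
      le_div_iff₀ (Real.exp_pos 1), one_mul] at this
    exact this
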